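/- Let $p\ge 2$ and let $(X,d,\mu)$ be a nonempty complete metric space with a Borel measure $\mu$ that is doubling with constant $C_\mu\ge 1$, that is, $0<\mu(B(x,2r))\le C_\mu\,\mu(B(x,r))<\infty$ for all $x\in X$, $r>0$. Suppose that $X$ supports a weak $(1,p)$-Poincaré inequality: there are $C>0$ and $\lambda\ge1$ such that $$\frac1{\mu(B(x,r))}\int_{B(x,r)}|u-u_{B(x,r)}|\,d\mu\le C\,r\Big(\frac1{\mu(B(x,\lambda r))}\int_{B(x,\lambda r)}g^p\,d\mu\Big)^{1/p},\qquad u_{B(x,r)}=\frac1{\mu(B(x,r))}\int_{B(x,r)}u\,d\mu,$$ for every $u\in L^1_{\mathrm{loc}}(X)$, every upper gradient $g$ of $u$ and every ball $B(x,r)$. Here a Borel function $g:X\to[0,\infty]$ is an upper gradient of $u:X\to[-\infty,\infty]$ if $|u(x)-u(y)|\le\int_\gamma g\,ds$ for every nonconstant rectifiable path $\gamma$ with endpoints $x,y$ (the left side being $\infty$ if $u(x)=u(y)=\pm\infty$), and a $p$-weak upper gradient if this holds for all such paths outside a family of zero $p$-modulus. Let $N^{1,p}(X)$ be the Newtonian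 space of $p$-integrable functions having a $p$-integrable upper gradient, and let $N^{1,p}_{\mathrm{loc}}(X)$ be the space of functions $u$ such that every point of $X$ has an open neighbourhood $U$ with $u\in N^{1,p}(U)$. For $u\in N^{1,p}_{\mathrm{loc}}(X)$ let $g_u\in L^p_{\mathrm{loc}}(X)$ denote its minimal $p$-weak upper gradient, that is, $g_u\le g$ $\mu$-almost everywhere for every $p$-weak upper gradient $g\in L^p_{\mathrm{loc}}(X)$ of $u$. A positive variational minimizer for $-\Delta_p u=f(u)$ is a function $u\in N^{1,p}_{\mathrm{loc}}(X)$, positive in $X$, such that for every $\phi\in N^{1,p}(X)$ with compact support one has $f(u)\phi\in L^1_{\mathrm{loc}}(X)$, $f'(u)\phi^2\in L^1_{\mathrm{loc}}(X)$, $$\int_{\operatorname{supp}\phi}g_u^p\,d\mu\le\int_{\operatorname{supp}\phi}g_{u+\phi}^p\,d\mu-\int_X f(u)\phi\,d\mu$$ and $$\int_X f'(u)\phi^2\,d\mu\le(p-1)\int_X g_u^{p-2}g_\phi^2\,d\mu .$$ Set $m=\log_2 C_\mu$ and let $$\delta>\frac{(p^2-3p+2)^2}{4(p-1)^2},\qquad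 \delta_p=\frac{2\delta+p-1+2\sqrt{\delta(\delta+p-1)}}{p-1}.$$ If $$m<\frac{p(\delta+\delta_p)}{\delta+p-1},$$ then there is no positive variational minimizer in $N^{1,p}_{\mathrm{loc}}(X)$ for $\Delta_p u=u^{-\delta}$, that is, for $f(t)=-t^{-\delta}$. -/

import Mathlib

open MeasureTheory Set Topology

noncomputable section

namespace MetricNewtonian

/-- A nonconstant rectifiable path in `X`: a continuous map from a compact interval `[a, b]` to `X`
of finite length. Only the values of `toFun` on `[a, b]` are relevant. -/
structure RectifiablePath (X : Type*) [MetricSpace X] where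
  a : ℝ
  b : ℝ
  a_le_b : a ≤ b
  toFun : ℝ → X
  continuousOn : ContinuousOn toFun (Icc a b)
  rectifiable : eVariationOn toFun (Icc a b) ≠ ⊤
  nonconstant : ∃ t ∈ Icc a b, toFun t ≠ toFun a

section

variable {X : Type*} [MetricSpace X]

namespace RectifiablePath

/-- The length of a path. -/
def length (γ : RectifiablePath X) : ℝ :=
  (eVariationOn γ.toFun (Icc γ.a γ.b)).toReal

/-- The path integral `∫_γ g ds`: the integral of `g` along the arc length parametrization
`[0, length γ] → X` of `γ`. -/
def pathIntegral (γ : RectifiablePath X) (g : X → ENNReal) : ENNReal :=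
  ∫⁻ s in Icc 0 γ.length, g (naturalParameterization γ.toFun (Icc γ.a γ.b) γ.a s)

end RectifiablePath

/-- The inequality `|u(x) - u(y)| ≤ ∫_γ g ds`, where `x` and `y` are the endpoints of `γ`.
In `EReal` one has `⊤ - ⊤ = ⊥ - ⊥ = ⊥`, so that the left side is `∞` as soon as one of
`u(x)`, `u(y)` is infinite, also when `u(x) = u(y) = ±∞`. -/
def UpperGradientIneq (g : X → ENNReal) (u : X → EReal) (γ : RectifiablePath X) : Prop :=
  (u (γ.toFun γ.a) - u (γ.toFun γ.b)).abs ≤ γ.pathIntegral g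

variable [MeasurableSpace X]

/-- `g` is an upper gradient of `u` in the subset `U` (regarded as a metric space in its own right):
a Borel function for which the upper gradient inequality holds on every nonconstant rectifiable
path in `U`. -/
def IsUpperGradientOn (U : Set X) (g : X → ENNReal) (u : X → EReal) : Prop :=
  Measurable g ∧
    ∀ γ : RectifiablePath X, (∀ t ∈ Icc γ.a γ.b, γ.toFun t ∈ U) → UpperGradientIneq g u γ

/-- `g` is an upper gradient of `u` in `X`. -/
def IsUpperGradient (g : X → ENNReal) (u : X → EReal) : Prop :=
  IsUpperGradientOn univ g u

/-- The `p`-modulus of a family of paths. -/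
def modulus (p : ℝ) (μ : Measure X) (Γ : Set (RectifiablePath X)) : ENNReal :=
  ⨅ (ρ : X → ENNReal) (_ : Measurable ρ) (_ : ∀ γ ∈ Γ, 1 ≤ γ.pathIntegral ρ),
    ∫⁻ x, ρ x ^ p ∂μ

/-- `g` is a `p`-weak upper gradient of `u` in `X`: the upper gradient inequality holds outside a
path family of zero `p`-modulus. -/
def IsWeakUpperGradient (p : ℝ) (μ : Measure X) (g : X → ENNReal) (u : X → EReal) : Prop :=
  Measurable g ∧ ∃ Γ : Set (RectifiablePath X), modulus p μ Γ = 0 ∧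
    ∀ γ : RectifiablePath X, γ ∉ Γ → UpperGradientIneq g u γ

/-- `g ∈ L^p_loc(X)`, for nonnegative `g`. -/
def LocallyPIntegrable (p : ℝ) (μ : Measure X) (g : X → ENNReal) : Prop :=
  ∀ x : X, ∃ U : Set X, IsOpen U ∧ x ∈ U ∧ ∫⁻ y in U, g y ^ p ∂μ < ⊤

/-- `g` is the minimal `p`-weak upper gradient `g_u` of `u` (unique up to sets of measure zero):
a `p`-weak upper gradient in `L^p_loc(X)` that is a.e. at most any other one. -/
def IsMinimalWeakUpperGradient (p : ℝ) (μ : Measure X) (g : X → ENNReal) (u : X → EReal) : Prop :=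
  IsWeakUpperGradient p μ g u ∧ LocallyPIntegrable p μ g ∧
    ∀ h : X → ENNReal, IsWeakUpperGradient p μ h u → LocallyPIntegrable p μ h →
      ∀ᵐ x ∂μ, g x ≤ h x

/-- `u` (an everywhere defined representative) belongs to `N^{1,p}(U)`: it is `p`-integrable on `U`
and has a `p`-integrable upper gradient in `U`. -/
def MemNewtonianOn (p : ℝ) (μ : Measure X) (U : Set X) (u : X → EReal) : Prop :=
  AEMeasurable u (μ.restrict U) ∧ ∫⁻ x in U, (u x).abs ^ p ∂μ < ⊤ ∧
    ∃ g : X → ENNReal, IsUpperGradientOn U g u ∧ ∫⁻ x in U, g x ^ p ∂μ < ⊤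

/-- `u ∈ N^{1,p}(X)`. -/
def MemNewtonian (p : ℝ) (μ : Measure X) (u : X → EReal) : Prop :=
  MemNewtonianOn p μ univ u

/-- `u ∈ N^{1,p}_loc(X)`. -/
def MemNewtonianLoc (p : ℝ) (μ : Measure X) (u : X → EReal) : Prop :=
  ∀ x : X, ∃ U : Set X, IsOpen U ∧ x ∈ U ∧ MemNewtonianOn p μ U u

/-- `μ` is doubling, with doubling constant `C`:
`0 < μ(B(x,2r)) ≤ C μ(B(x,r)) < ∞` for all `x` and all `r > 0`. -/
def IsDoublingWith (μ : Measure X) (C : ℝ) : Prop :=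
  1 ≤ C ∧ ∀ (x : X) (r : ℝ), 0 < r →
    0 < μ (Metric.ball x (2 * r)) ∧
    μ (Metric.ball x (2 * r)) ≤ ENNReal.ofReal C * μ (Metric.ball x r) ∧
    ENNReal.ofReal C * μ (Metric.ball x r) < ⊤

/-- `X` supports a weak `(1,p)`-Poincaré inequality. -/
def SupportsPoincare (p : ℝ) (μ : Measure X) : Prop :=
  ∃ C lam : ℝ, 0 < C ∧ 1 ≤ lam ∧
    ∀ (u : X → ℝ) (g : X → ENNReal), LocallyIntegrable u μ →
      IsUpperGradient g (fun x => (u x : EReal)) →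
      ∀ (x : X) (r : ℝ), 0 < r →
        ENNReal.ofReal
            (⨍ y in Metric.ball x r, |u y - ⨍ z in Metric.ball x r, u z ∂μ| ∂μ) ≤
          ENNReal.ofReal (C * r) *
            (⨍⁻ y in Metric.ball x (lam * r), g y ^ p ∂μ) ^ (1 / p)

/-- `u` is a positive variational minimizer in `N^{1,p}_loc(X)` corresponding to `-Δ_p u = f(u)`.
Since `u` and `u + φ` agree off the support `K` of `φ`, so do their minimal `p`-weak upper gradients
(a.e.), and the energies are compared on the compact set `K`, where they are finite.
The functions `gu`, `gφ`, `guφ` are the (a.e. unique) minimal `p`-weak upper gradients of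
`u`, `φ`, `u + φ`. The function `u` is finite a.e., so `(u x).toReal` is `u x` for a.e. `x`. -/
def IsVariationalMinimizer (p : ℝ) (μ : Measure X) (f : ℝ → ℝ) (u : X → EReal) : Prop :=
  MemNewtonianLoc p μ u ∧ (∀ x, 0 < u x) ∧
    ∀ φ : X → ℝ, MemNewtonian p μ (fun x => (φ x : EReal)) → HasCompactSupport φ →
      LocallyIntegrable (fun x => f (u x).toReal * φ x) μ ∧
      LocallyIntegrable (fun x => deriv f (u x).toReal * φ x ^ 2) μ ∧
      ∀ gu gφ guφ : X → ENNReal,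
        IsMinimalWeakUpperGradient p μ gu u →
        IsMinimalWeakUpperGradient p μ gφ (fun x => (φ x : EReal)) →
        IsMinimalWeakUpperGradient p μ guφ (fun x => u x + (φ x : EReal)) →
        ((∫⁻ x in tsupport φ, gu x ^ p ∂μ : ENNReal) : EReal) ≤
            ((∫⁻ x in tsupport φ, guφ x ^ p ∂μ : ENNReal) : EReal) -
              ((∫ x, f (u x).toReal * φ x ∂μ : ℝ) : EReal) ∧
        ((∫ x, deriv f (u x).toReal * φ x ^ 2 ∂μ : ℝ) : EReal) ≤
          ((ENNReal.ofReal (p - 1) * ∫⁻ x, gu x ^ (p - 2) * gφ x ^ (2 : ℝ) ∂μ : ENNReal) : EReal)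

end

end MetricNewtonian

end

/-! Write `η` for a cutoff equal to 1 on `B(x₀, R)` and vanishing off the closed ball of radius
`2R`, and put `a = (u+1)^{-α-1} η^k` and `r = (u+1)/(ηR)`. Testing minimality with `φ = α⁻¹
(u+1)^{-α} η^k` works because `u + φ` has a weak upper gradient `(1-a) g_u + a (k/α) r`. Since `0 ≤
a ≤ 1`, convexity of `t ↦ t^p` bounds its `p`-th power by `(1-a) g_u^p + a ((k/α) r)^p`. This gives
the Caccioppoli inequality `∫ a g_u^p ≤ (k/α)^p ∫ a r^p + α⁻¹ I`, where `I = ∫ u^{-δ} (u+1)^{-α}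
η^k` (`IsVariationalMinimizer.caccioppoli`).

Testing stability with `(u+1)^{-(α-1)/2} η^j`, `k = 2j`, bounds `δ I` by `(p-1)(((α-1)/2)^2 + ε) ∫ a
g_u^p` plus a multiple of `∫ a r^p` (`IsVariationalMinimizer.stability`). Combining the two, `I` can
be absorbed as soon as `(p-1)((α-1)/2)^2 < δα`, a quadratic condition on `α` whose larger root is
`δp`. A Young-type splitting (`weight_error_le`) absorbs `∫ a r^p` as well, up to `R^{-q} μ(B(x₀,
2R))` with `q = p(δ+α)/(δ+p-1)`. For `α` close to `δp` one has `m < q`, while doubling limits the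
volume growth to the power `m`. Hence the bound tends to 0 as `R → ∞`, although the integrand is
positive a.e. on a fixed ball.

The shift `u + 1` keeps the test functions bounded and Lipschitz in `u` without a positive lower
bound for `u`.

The variational inequalities speak of minimal weak upper gradients, so these must be shown to exist
(`exists_isMinimalWeakUpperGradient`) and to obey a chain rule (`IsWeakUpperGradient.chain`). Both
come from restricting to almost every path, where functions become absolutely continuous and upper
gradients become bounds on derivatives. -/

set_option linter.unusedSectionVars false

/-! ### Arc length parametrization and subpaths. -/

noncomputable section

namespace MetricNewtonian

namespace RectifiablePath

variable {X : Type*} [MetricSpace X] (γ : RectifiablePath X)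

/-- The arc length parametrization of a path. -/
def curve : ℝ → X := naturalParameterization γ.toFun (Icc γ.a γ.b) γ.a

lemma left_mem : γ.a ∈ Icc γ.a γ.b := left_mem_Icc.2 γ.a_le_b

lemma right_mem : γ.b ∈ Icc γ.a γ.b := right_mem_Icc.2 γ.a_le_b

lemma locallyBoundedVariationOn : LocallyBoundedVariationOn γ.toFun (Icc γ.a γ.b) :=
  BoundedVariationOn.locallyBoundedVariationOn γ.rectifiable

/-- The one-sided limits of the variation function differ from its value by the jumps of the path,
which vanish by continuity. -/
lemma continuousOn_variationOnFromTo :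
    ContinuousOn (variationOnFromTo γ.toFun (Icc γ.a γ.b) γ.a) (Icc γ.a γ.b) := by
  intro b hb
  have hl := variationOnFromTo.tendsto_left (l := γ.toFun b) γ.left_mem hb
    γ.locallyBoundedVariationOn ((γ.continuousOn b hb).mono_left (nhdsWithin_mono _ inter_subset_left))
  have hr := variationOnFromTo.tendsto_right (l := γ.toFun b) γ.left_mem hb
    γ.locallyBoundedVariationOn ((γ.continuousOn b hb).mono_left (nhdsWithin_mono _ inter_subset_left))
  rw [dist_self, sub_zero] at hl
  rw [dist_self, add_zero] at hr
  have h1 : ContinuousWithinAt (variationOnFromTo γ.toFun (Icc γ.a γ.b) γ.a)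
      ((Icc γ.a γ.b ∩ Iio b) ∪ (Icc γ.a γ.b ∩ Ioi b)) b :=
    ContinuousWithinAt.union hl hr
  refine (h1.insert).mono fun x hx => ?_
  rcases lt_trichotomy x b with h | h | h
  · exact Or.inr (Or.inl ⟨hx, h⟩)
  · exact Or.inl h
  · exact Or.inr (Or.inr ⟨hx, h⟩)

lemma variationOnFromTo_right :
    variationOnFromTo γ.toFun (Icc γ.a γ.b) γ.a γ.b = γ.length := by
  rw [variationOnFromTo.eq_of_le _ _ γ.a_le_b, inter_self]; rfl

lemma image_variationOnFromTo :
    variationOnFromTo γ.toFun (Icc γ.a γ.b) γ.a '' Icc γ.a γ.b = Icc 0 γ.length := by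
  rw [γ.continuousOn_variationOnFromTo.image_Icc_of_monotoneOn γ.a_le_b
    (variationOnFromTo.monotoneOn γ.locallyBoundedVariationOn γ.left_mem),
    variationOnFromTo.self, variationOnFromTo_right]

lemma hasUnitSpeedOn_curve : HasUnitSpeedOn γ.curve (Icc 0 γ.length) := by
  rw [← γ.image_variationOnFromTo]
  exact has_unit_speed_naturalParameterization _ γ.locallyBoundedVariationOn γ.left_mem

lemma curve_variationOnFromTo {t : ℝ} (ht : t ∈ Icc γ.a γ.b) :
    γ.curve (variationOnFromTo γ.toFun (Icc γ.a γ.b) γ.a t) = γ.toFun t :=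
  edist_eq_zero.1 (edist_naturalParameterization_eq_zero γ.locallyBoundedVariationOn γ.left_mem ht)

lemma curve_zero : γ.curve 0 = γ.toFun γ.a := by
  rw [← γ.curve_variationOnFromTo γ.left_mem, variationOnFromTo.self]

lemma curve_length : γ.curve γ.length = γ.toFun γ.b := by
  rw [← γ.curve_variationOnFromTo γ.right_mem, variationOnFromTo_right]

lemma exists_curve_eq {s : ℝ} (hs : s ∈ Icc 0 γ.length) :
    ∃ t ∈ Icc γ.a γ.b, γ.curve s = γ.toFun t := by
  rw [← γ.image_variationOnFromTo] at hs
  obtain ⟨t, ht, rfl⟩ := hs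
  exact ⟨t, ht, γ.curve_variationOnFromTo ht⟩

lemma length_pos : 0 < γ.length := by
  obtain ⟨t, ht, hne⟩ := γ.nonconstant
  rw [← γ.variationOnFromTo_right]
  refine lt_of_le_of_ne (variationOnFromTo.nonneg_of_le _ _ γ.a_le_b) fun h => hne ?_
  have := (variationOnFromTo.eq_zero_iff_of_le γ.locallyBoundedVariationOn γ.left_mem γ.right_mem
    γ.a_le_b).1 h.symm ⟨ht, ht⟩ ⟨γ.left_mem, γ.left_mem⟩
  exact edist_eq_zero.1 this

lemma eVariationOn_curve {s t : ℝ} (hs : 0 ≤ s) (hst : s ≤ t) (ht : t ≤ γ.length) :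
    eVariationOn γ.curve (Icc s t) = ENNReal.ofReal (t - s) := by
  have := γ.hasUnitSpeedOn_curve ⟨hs, hst.trans ht⟩ ⟨hs.trans hst, ht⟩
  rwa [inter_eq_self_of_subset_right (Icc_subset_Icc hs ht), NNReal.coe_one, one_mul] at this

lemma lipschitzOnWith_curve : LipschitzOnWith 1 γ.curve (Icc 0 γ.length) := by
  have key : ∀ s ∈ Icc 0 γ.length, ∀ t ∈ Icc 0 γ.length, s ≤ t →
      edist (γ.curve s) (γ.curve t) ≤ edist s t := by
    intro s hs t ht hst
    refine (eVariationOn.edist_le γ.curve (left_mem_Icc.2 hst) (right_mem_Icc.2 hst)).trans ?_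
    rw [γ.eVariationOn_curve hs.1 hst ht.2, edist_comm, edist_dist, Real.dist_eq,
      abs_of_nonneg (sub_nonneg.2 hst)]
  intro s hs t ht
  rw [ENNReal.coe_one, one_mul]
  rcases le_total s t with h | h
  · exact key s hs t ht h
  · rw [edist_comm, edist_comm s]; exact key t ht s hs h

lemma continuousOn_curve : ContinuousOn γ.curve (Icc 0 γ.length) :=
  γ.lipschitzOnWith_curve.continuousOn

lemma pathIntegral_eq (g : X → ENNReal) :
    γ.pathIntegral g = ∫⁻ s in Icc 0 γ.length, g (γ.curve s) := rfl

/-- The part of a path between the arc length parameters `s < t`. -/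
def sub {s t : ℝ} (hs : 0 ≤ s) (hst : s < t) (ht : t ≤ γ.length) : RectifiablePath X where
  a := s
  b := t
  a_le_b := hst.le
  toFun := γ.curve
  continuousOn := γ.continuousOn_curve.mono (Icc_subset_Icc hs ht)
  rectifiable := by
    rw [γ.eVariationOn_curve hs hst.le ht]; exact ENNReal.ofReal_ne_top
  nonconstant := by
    by_contra! h
    have h0 := γ.eVariationOn_curve hs hst.le ht
    rw [eVariationOn.constant_on, eq_comm, ENNReal.ofReal_eq_zero] at h0
    · linarith
    · rintro _ ⟨x, hx, rfl⟩ _ ⟨y, hy, rfl⟩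
      rw [h x hx, h y hy]

variable {s t : ℝ} (hs : 0 ≤ s) (hst : s < t) (ht : t ≤ γ.length)

lemma length_sub : (γ.sub hs hst ht).length = t - s := by
  change (eVariationOn γ.curve (Icc s t)).toReal = _
  rw [γ.eVariationOn_curve hs hst.le ht, ENNReal.toReal_ofReal (by linarith)]

/-- The subpath already has unit speed, so its own arc length parameter is the old one shifted by
`s`. -/
lemma curve_sub {r : ℝ} (hr : r ∈ Icc 0 (t - s)) :
    (γ.sub hs hst ht).curve r = γ.curve (s + r) := by
  have hmem : s + r ∈ Icc s t := ⟨by linarith [hr.1], by linarith [hr.2]⟩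
  have := (γ.sub hs hst ht).curve_variationOnFromTo hmem
  rw [variationOnFromTo.eq_of_le (a := (γ.sub hs hst ht).a) _ _ hmem.1] at this
  change (γ.sub hs hst ht).curve (eVariationOn γ.curve (Icc s t ∩ Icc s (s + r))).toReal =
    γ.curve (s + r) at this
  rwa [inter_eq_self_of_subset_right (Icc_subset_Icc_right hmem.2),
    γ.eVariationOn_curve hs hmem.1 (hmem.2.trans ht), ENNReal.toReal_ofReal (by linarith [hr.1]),
    add_sub_cancel_left] at this

lemma pathIntegral_sub (g : X → ENNReal) :
    (γ.sub hs hst ht).pathIntegral g = ∫⁻ r in Icc s t, g (γ.curve r) := by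
  rw [pathIntegral_eq, length_sub, ← lintegral_indicator measurableSet_Icc,
    ← lintegral_indicator measurableSet_Icc,
    ← lintegral_add_left_eq_self ((Icc s t).indicator fun r => g (γ.curve r)) s]
  congr 1
  ext r
  by_cases hr : r ∈ Icc 0 (t - s)
  · rw [indicator_of_mem hr, indicator_of_mem (show s + r ∈ Icc s t from ⟨by linarith [hr.1], by linarith [hr.2]⟩),
      γ.curve_sub hs hst ht hr]
  · rw [indicator_of_notMem hr, indicator_of_notMem]
    exact fun h => hr ⟨by linarith [h.1], by linarith [h.2]⟩

end RectifiablePath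

end MetricNewtonian
end

/-! ### Increment bounds and absolutely continuous functions on an interval. -/

noncomputable section

namespace MetricNewtonian

open Filter AbsolutelyContinuousOnInterval in
lemma absolutelyContinuousOnInterval_of_dist_le {f g : ℝ → ℝ} {a b : ℝ}
    (hg : AbsolutelyContinuousOnInterval g a b)
    (h : ∀ s ∈ uIcc a b, ∀ t ∈ uIcc a b, dist (f s) (f t) ≤ dist (g s) (g t)) :
    AbsolutelyContinuousOnInterval f a b := by
  refine squeeze_zero' (Eventually.of_forall fun E => Finset.sum_nonneg fun i _ => dist_nonneg) ?_ hg
  have : ∀ᶠ E in totalLengthFilter ⊓ 𝓟 (disjWithin a b), E ∈ disjWithin a b :=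
    mem_inf_of_right (mem_principal_self _)
  filter_upwards [this] with E hE
  exact Finset.sum_le_sum fun i hi => h _ (hE.1 i hi).1 _ (hE.1 i hi).2

open Filter in
lemma abs_deriv_le_of_abs_sub_le {f g : ℝ → ℝ} {f' g' x : ℝ} (hf : HasDerivAt f f' x)
    (hg : HasDerivAt g g' x) (h : ∀ᶠ y in 𝓝 x, |f y - f x| ≤ |g y - g x|) : |f'| ≤ |g'| := by
  rw [hasDerivAt_iff_tendsto_slope] at hf hg
  refine le_of_tendsto_of_tendsto hf.abs hg.abs ?_
  filter_upwards [h.filter_mono nhdsWithin_le_nhds] with y hy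
  rw [slope_def_field, slope_def_field, abs_div, abs_div]
  gcongr

/-- `G` controls the increments of `v` on `[a, b]`. -/
def IncrementBound (v : ℝ → ℝ) (G : ℝ → ENNReal) (a b : ℝ) : Prop :=
  ∀ s t, a ≤ s → s < t → t ≤ b → ENNReal.ofReal |v s - v t| ≤ ∫⁻ r in Icc s t, G r

section

variable {v : ℝ → ℝ} {G : ℝ → ENNReal} {a b : ℝ}

lemma intervalIntegrable_toReal (hab : a ≤ b) (hG : AEMeasurable G (volume.restrict (Icc a b)))
    (hfin : ∫⁻ r in Icc a b, G r ≠ ⊤) :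
    IntervalIntegrable (fun r => (G r).toReal) volume a b := by
  rw [intervalIntegrable_iff_integrableOn_Icc_of_le hab]
  exact integrable_toReal_of_lintegral_ne_top hG hfin

/-- The increments of `v` are dominated by those of a primitive of `G`. Absolute continuity and the
derivative bound are then inherited from that primitive. -/
lemma IncrementBound.abs_sub_le (h : IncrementBound v G a b)
    (hG : AEMeasurable G (volume.restrict (Icc a b))) (hfin : ∫⁻ r in Icc a b, G r ≠ ⊤)
    {s t : ℝ} (hs : s ∈ Icc a b) (ht : t ∈ Icc a b) :
    |v s - v t| ≤ |(∫ r in a..s, (G r).toReal) - ∫ r in a..t, (G r).toReal| := by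
  wlog hst : s < t generalizing s t
  · rcases eq_or_lt_of_le (not_lt.1 hst) with rfl | h'
    · simp
    · rw [abs_sub_comm, abs_sub_comm (∫ r in a..s, (G r).toReal)]
      exact this ht hs h'
  have hab : a ≤ b := hs.1.trans hs.2
  have hi := intervalIntegrable_toReal hab hG hfin
  have hsub : Icc s t ⊆ Icc a b := Icc_subset_Icc hs.1 ht.2
  rw [abs_sub_comm (∫ r in a..s, (G r).toReal), intervalIntegral.integral_interval_sub_left
    (hi.mono_set (by rw [uIcc_of_le ht.1, uIcc_of_le hab]; exact Icc_subset_Icc_right ht.2))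
    (hi.mono_set (by rw [uIcc_of_le hs.1, uIcc_of_le hab]; exact Icc_subset_Icc_right hs.2)),
    intervalIntegral.integral_of_le hst.le, ← integral_Icc_eq_integral_Ioc,
    integral_toReal (hG.mono_measure (Measure.restrict_mono hsub le_rfl))]
  · rw [abs_of_nonneg ENNReal.toReal_nonneg]
    have := h s t hs.1 hst ht.2
    rwa [ENNReal.ofReal_le_iff_le_toReal] at this
    exact ne_top_of_le_ne_top hfin (lintegral_mono_set hsub)
  · exact ae_lt_top' (hG.mono_measure (Measure.restrict_mono hsub le_rfl))
      (ne_top_of_le_ne_top hfin (lintegral_mono_set hsub))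

lemma IncrementBound.absolutelyContinuous (h : IncrementBound v G a b) (hab : a ≤ b)
    (hG : AEMeasurable G (volume.restrict (Icc a b))) (hfin : ∫⁻ r in Icc a b, G r ≠ ⊤) :
    AbsolutelyContinuousOnInterval v a b := by
  refine absolutelyContinuousOnInterval_of_dist_le
    ((intervalIntegrable_toReal hab hG hfin).absolutelyContinuousOnInterval_intervalIntegral
      (c := a) left_mem_uIcc) fun s hs t ht => ?_
  rw [uIcc_of_le hab] at hs ht
  exact h.abs_sub_le hG hfin hs ht

lemma IncrementBound.ae_abs_deriv_le (h : IncrementBound v G a b) (hab : a ≤ b)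
    (hG : AEMeasurable G (volume.restrict (Icc a b))) (hfin : ∫⁻ r in Icc a b, G r ≠ ⊤) :
    ∀ᵐ x, x ∈ Icc a b → DifferentiableAt ℝ v x ∧ ENNReal.ofReal |deriv v x| ≤ G x := by
  have h1 : ∀ᵐ x : ℝ, x ≠ a := by simp [ae_iff, measure_singleton]
  have h2 : ∀ᵐ x : ℝ, x ≠ b := by simp [ae_iff, measure_singleton]
  filter_upwards [(h.absolutelyContinuous hab hG hfin).ae_differentiableAt,
    (intervalIntegrable_toReal hab hG hfin).ae_hasDerivAt_integral, h1, h2] with x hx hx' hxa hxb hmem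
  rw [uIcc_of_le hab] at hx hx'
  refine ⟨hx hmem, ?_⟩
  have := abs_deriv_le_of_abs_sub_le (hx hmem).hasDerivAt (hx' hmem a (left_mem_Icc.2 hab)) <| by
    filter_upwards [Icc_mem_nhds (lt_of_le_of_ne hmem.1 hxa.symm) (lt_of_le_of_ne hmem.2 hxb)]
      with y hy
    exact h.abs_sub_le hG hfin hy hmem
  rw [abs_of_nonneg ENNReal.toReal_nonneg (a := (G x).toReal)] at this
  exact (ENNReal.ofReal_le_ofReal this).trans ENNReal.ofReal_toReal_le

/-- Converse to `IncrementBound.ae_abs_deriv_le`: along a path, upper gradient inequalities can be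
proved pointwise a.e. on derivatives and then integrated back. -/
lemma incrementBound_of_ae_abs_deriv_le (hv : AbsolutelyContinuousOnInterval v a b)
    (h : ∀ᵐ x, x ∈ Icc a b → ENNReal.ofReal |deriv v x| ≤ G x) : IncrementBound v G a b := by
  intro s t hs hst ht
  have hab : a ≤ b := hs.trans (hst.le.trans ht)
  have hsub : Icc s t ⊆ Icc a b := Icc_subset_Icc hs ht
  have hv' := hv.mono (c := s) (d := t) (by rwa [uIcc_of_le hst.le, uIcc_of_le hab])
  rw [abs_sub_comm, ← hv'.integral_deriv_eq_sub, intervalIntegral.integral_of_le hst.le,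
    ← integral_Icc_eq_integral_Ioc, ← Real.norm_eq_abs, ofReal_norm]
  refine (enorm_integral_le_lintegral_enorm _).trans (lintegral_mono_ae ?_)
  filter_upwards [ae_restrict_of_ae h, ae_restrict_mem measurableSet_Icc] with x hx hmem
  rw [← ofReal_norm]
  exact hx (hsub hmem)

end

end MetricNewtonian
end

/-! ### Path families of zero modulus, densities and good paths. -/

noncomputable section

namespace MetricNewtonian

variable {X : Type*} [MetricSpace X] [MeasurableSpace X] {p : ℝ} {μ : Measure X}

/-- The `p`-th power of a supremum is at most the sum of the `p`-th powers. Taking suprema instead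
of sums of densities avoids Minkowski's inequality. -/
lemma lintegral_iSup_mul_rpow_le (hp : 0 < p) {ρ : ℕ → X → ENNReal} (hρ : ∀ n, Measurable (ρ n))
    (c : ℕ → ENNReal) :
    ∫⁻ x, (⨆ n, c n * ρ n x) ^ p ∂μ ≤ ∑' n, c n ^ p * ∫⁻ x, ρ n x ^ p ∂μ := by
  calc ∫⁻ x, (⨆ n, c n * ρ n x) ^ p ∂μ ≤ ∫⁻ x, ∑' n, c n ^ p * ρ n x ^ p ∂μ := by
        refine lintegral_mono fun x => ?_
        rw [← ENNReal.le_rpow_inv_iff hp]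
        refine iSup_le fun n => ?_
        rw [ENNReal.le_rpow_inv_iff hp, ENNReal.mul_rpow_of_nonneg _ _ hp.le]
        exact ENNReal.le_tsum n
    _ = ∑' n, c n ^ p * ∫⁻ x, ρ n x ^ p ∂μ := by
        rw [lintegral_tsum fun n => (((hρ n).pow_const p).const_mul _).aemeasurable]
        congr 1
        ext n
        rw [lintegral_const_mul _ ((hρ n).pow_const p)]

lemma mul_pathIntegral_le_pathIntegral_iSup (γ : RectifiablePath X) (ρ : ℕ → X → ENNReal)
    (c : ℕ → ENNReal) (n : ℕ) (hc : c n ≠ ⊤) :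
    c n * γ.pathIntegral (ρ n) ≤ γ.pathIntegral fun x => ⨆ n, c n * ρ n x := by
  rw [RectifiablePath.pathIntegral, ← lintegral_const_mul' _ _ hc]
  exact lintegral_mono fun s => le_iSup (fun n => c n * ρ n _) n

/-- A density whose finiteness on a path entails that of countably many given ones. -/
lemma exists_density_forall_pathIntegral_ne_top (hp : 0 < p) {ρ : ℕ → X → ENNReal}
    (hρ : ∀ n, Measurable (ρ n)) (hfin : ∀ n, ∫⁻ x, ρ n x ^ p ∂μ ≠ ⊤) :
    ∃ σ : X → ENNReal, Measurable σ ∧ ∫⁻ x, σ x ^ p ∂μ ≠ ⊤ ∧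
      ∀ γ : RectifiablePath X, γ.pathIntegral σ ≠ ⊤ → ∀ n, γ.pathIntegral (ρ n) ≠ ⊤ := by
  obtain ⟨ε, hε, hsum⟩ := ENNReal.exists_pos_sum_of_countable one_ne_zero ℕ
  -- Scaled so that `c n ^ p * ∫ ρ n ^ p ≤ ε n`, which is summable; only positivity of `c n` matters
  -- for recovering finiteness of each path integral.
  set c : ℕ → ENNReal := fun n => (ε n / (1 + ∫⁻ x, ρ n x ^ p ∂μ)) ^ p⁻¹ with hc
  have hc0 : ∀ n, c n ≠ 0 := fun n => by
    have : (ε n : ENNReal) / (1 + ∫⁻ x, ρ n x ^ p ∂μ) ≠ 0 :=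
      ENNReal.div_ne_zero.2 ⟨by exact_mod_cast (hε n).ne', by simp [hfin n]⟩
    simp only [hc, ne_eq, ENNReal.rpow_eq_zero_iff, not_or, not_and, this, false_imp_iff, true_and]
    intro _
    simpa using hp.le
  have hct : ∀ n, c n ≠ ⊤ := fun n =>
    ENNReal.rpow_ne_top_of_nonneg (inv_nonneg.2 hp.le)
      (ENNReal.div_ne_top ENNReal.coe_ne_top (by simp))
  refine ⟨fun x => ⨆ n, c n * ρ n x, Measurable.iSup fun n => (hρ n).const_mul _, ?_, ?_⟩
  · refine ne_top_of_le_ne_top ?_ (lintegral_iSup_mul_rpow_le hp hρ c)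
    refine ne_top_of_le_ne_top ENNReal.one_ne_top
      ((ENNReal.tsum_le_tsum fun n => ?_).trans hsum.le)
    rw [hc]
    simp only
    rw [ENNReal.rpow_inv_rpow hp.ne', div_eq_mul_inv, mul_assoc]
    refine mul_le_of_le_one_right' ?_
    rw [mul_comm, ← div_eq_mul_inv]
    exact ENNReal.div_le_of_le_mul (by rw [one_mul]; exact le_add_self)
  · intro γ hγ n h
    have := mul_pathIntegral_le_pathIntegral_iSup γ ρ c n (hct n)
    rw [h, ENNReal.mul_top (hc0 n), top_le_iff] at this
    exact hγ this

lemma exists_density_pathIntegral_ne_top_and (hp : 0 < p) {ρ₁ ρ₂ : X → ENNReal}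
    (h₁ : Measurable ρ₁) (h₂ : Measurable ρ₂) (f₁ : ∫⁻ x, ρ₁ x ^ p ∂μ ≠ ⊤)
    (f₂ : ∫⁻ x, ρ₂ x ^ p ∂μ ≠ ⊤) :
    ∃ σ : X → ENNReal, Measurable σ ∧ ∫⁻ x, σ x ^ p ∂μ ≠ ⊤ ∧
      ∀ γ : RectifiablePath X, γ.pathIntegral σ ≠ ⊤ →
        γ.pathIntegral ρ₁ ≠ ⊤ ∧ γ.pathIntegral ρ₂ ≠ ⊤ := by
  obtain ⟨σ, hσ, hf, h⟩ := exists_density_forall_pathIntegral_ne_top (μ := μ) hp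
    (ρ := fun n => if n = 0 then ρ₁ else ρ₂) (fun n => by split_ifs <;> assumption)
    (fun n => by split_ifs <;> assumption)
  exact ⟨σ, hσ, hf, fun γ hγ => ⟨by simpa using h γ hγ 0, by simpa using h γ hγ 1⟩⟩

/-- Choose admissible `ρ n` of such small energy that the energies of `2^n ρ n` are summable; the
supremum of these then has path integral at least `2^n` for every `n`. -/
lemma exists_density_of_modulus_eq_zero (hp : 0 < p) {Γ : Set (RectifiablePath X)}
    (h : modulus p μ Γ = 0) :
    ∃ ρ : X → ENNReal, Measurable ρ ∧ ∫⁻ x, ρ x ^ p ∂μ ≠ ⊤ ∧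
      ∀ γ ∈ Γ, γ.pathIntegral ρ = ⊤ := by
  obtain ⟨ε, hε, hsum⟩ := ENNReal.exists_pos_sum_of_countable one_ne_zero ℕ
  have hc0 : ∀ n : ℕ, ((2 : ENNReal) ^ n) ^ p ≠ 0 := fun n => by
    simp [ENNReal.rpow_eq_zero_iff]
  have hct : ∀ n : ℕ, ((2 : ENNReal) ^ n) ≠ ⊤ := fun n => ENNReal.pow_ne_top (by simp)
  have hctp : ∀ n : ℕ, ((2 : ENNReal) ^ n) ^ p ≠ ⊤ := fun n =>
    ENNReal.rpow_ne_top_of_nonneg hp.le (hct n)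
  have : ∀ n : ℕ, ∃ ρ : X → ENNReal, Measurable ρ ∧ (∀ γ ∈ Γ, 1 ≤ γ.pathIntegral ρ) ∧
      ((2 : ENNReal) ^ n) ^ p * ∫⁻ x, ρ x ^ p ∂μ ≤ ε n := by
    intro n
    have hlt : modulus p μ Γ < ε n / ((2 : ENNReal) ^ n) ^ p := by
      rw [h]
      exact ENNReal.div_pos (by exact_mod_cast (hε n).ne') (hctp n)
    simp only [modulus, iInf_lt_iff] at hlt
    obtain ⟨ρ, h1, h2, h3⟩ := hlt
    refine ⟨ρ, h1, h2, ?_⟩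
    rw [mul_comm]
    exact ENNReal.mul_le_of_le_div h3.le
  choose ρ h1 h2 h3 using this
  refine ⟨fun x => ⨆ n, 2 ^ n * ρ n x, Measurable.iSup fun n => (h1 n).const_mul _, ?_, ?_⟩
  · exact ne_top_of_le_ne_top ENNReal.one_ne_top ((lintegral_iSup_mul_rpow_le hp h1 _).trans
      ((ENNReal.tsum_le_tsum h3).trans hsum.le))
  · intro γ hγ
    refine ENNReal.eq_top_of_forall_nnreal_le fun r => ?_
    obtain ⟨n, hn⟩ := pow_unbounded_of_one_lt r (one_lt_two)
    calc (r : ENNReal) ≤ 2 ^ n := by exact_mod_cast hn.le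
      _ ≤ 2 ^ n * γ.pathIntegral (ρ n) := le_mul_of_one_le_right' (h2 n γ hγ)
      _ ≤ _ := mul_pathIntegral_le_pathIntegral_iSup γ ρ _ n (hct n)

/-- Every multiple `ρ/(n+1)` remains admissible, and its energy tends to 0. -/
lemma modulus_eq_zero_of_density (hp : 0 < p) {Γ : Set (RectifiablePath X)} {ρ : X → ENNReal}
    (hρ : Measurable ρ) (hfin : ∫⁻ x, ρ x ^ p ∂μ ≠ ⊤) (h : ∀ γ ∈ Γ, γ.pathIntegral ρ = ⊤) :
    modulus p μ Γ = 0 := by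
  have key : ∀ n : ℕ, modulus p μ Γ ≤ (((n : ENNReal) + 1)⁻¹) ^ p * ∫⁻ x, ρ x ^ p ∂μ := by
    intro n
    have hn : ((n : ENNReal) + 1)⁻¹ ≠ ⊤ := by simp
    have h1 : ∀ γ ∈ Γ, 1 ≤ γ.pathIntegral fun x => ((n : ENNReal) + 1)⁻¹ * ρ x := fun γ hγ => by
      have := h γ hγ
      rw [RectifiablePath.pathIntegral] at this
      rw [RectifiablePath.pathIntegral, lintegral_const_mul' _ _ hn, this, ENNReal.mul_top]
      · exact le_top
      · simp
    calc modulus p μ Γ ≤ ∫⁻ x, (((n : ENNReal) + 1)⁻¹ * ρ x) ^ p ∂μ :=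
          iInf₂_le_of_le (fun x => ((n : ENNReal) + 1)⁻¹ * ρ x) (hρ.const_mul _) (iInf_le _ h1)
      _ = _ := by
          simp_rw [ENNReal.mul_rpow_of_nonneg _ _ hp.le]
          rw [lintegral_const_mul _ (hρ.pow_const p)]
  have hlim : Filter.Tendsto (fun n : ℕ => (((n : ENNReal) + 1)⁻¹) ^ p * ∫⁻ x, ρ x ^ p ∂μ)
      Filter.atTop (𝓝 (0 * ∫⁻ x, ρ x ^ p ∂μ)) := by
    refine ENNReal.Tendsto.mul_const ?_ (Or.inr hfin)
    have h1 : Filter.Tendsto (fun n : ℕ => ((n : ENNReal) + 1)⁻¹) Filter.atTop (𝓝 0) := by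
      have := (Filter.tendsto_add_atTop_iff_nat 1).2 ENNReal.tendsto_inv_nat_nhds_zero
      simpa using this
    have := (ENNReal.continuous_rpow_const (y := p)).continuousAt.tendsto.comp h1
    simpa [ENNReal.zero_rpow_of_pos hp, Function.comp_def] using this
  rw [zero_mul] at hlim
  exact le_antisymm (ge_of_tendsto' hlim key) zero_le

/-- Encoding exceptional families by one `p`-integrable density has two advantages: finiteness of
the path integral passes to subpaths, and countably many densities can be merged into one. -/
lemma isWeakUpperGradient_iff (hp : 0 < p) {g : X → ENNReal} {u : X → EReal} :
    IsWeakUpperGradient p μ g u ↔ Measurable g ∧ ∃ ρ : X → ENNReal, Measurable ρ ∧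
      ∫⁻ x, ρ x ^ p ∂μ ≠ ⊤ ∧
      ∀ γ : RectifiablePath X, γ.pathIntegral ρ ≠ ⊤ → UpperGradientIneq g u γ := by
  refine and_congr_right fun _ => ⟨?_, ?_⟩
  · rintro ⟨Γ, hΓ, h⟩
    obtain ⟨ρ, h1, h2, h3⟩ := exists_density_of_modulus_eq_zero hp hΓ
    exact ⟨ρ, h1, h2, fun γ hγ => h γ fun hmem => hγ (h3 γ hmem)⟩
  · rintro ⟨ρ, h1, h2, h3⟩
    exact ⟨{γ | γ.pathIntegral ρ = ⊤}, modulus_eq_zero_of_density hp h1 h2 fun γ hγ => hγ,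
      fun γ hγ => h3 γ hγ⟩

lemma LocallyPIntegrable.lintegral_lt_top {g : X → ENNReal} (hg : LocallyPIntegrable p μ g)
    {K : Set X} (hK : IsCompact K) : ∫⁻ x in K, g x ^ p ∂μ < ⊤ := by
  refine hK.induction_on (p := fun K => ∫⁻ x in K, g x ^ p ∂μ < ⊤) (by simp)
    (fun s t hst ht => (lintegral_mono_set hst).trans_lt ht)
    (fun s t hs ht => (lintegral_union_le _ s t).trans_lt (ENNReal.add_lt_top.2 ⟨hs, ht⟩)) ?_
  intro x _
  obtain ⟨U, hU, hx, h⟩ := hg x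
  exact ⟨U, mem_nhdsWithin_of_mem_nhds (hU.mem_nhds hx), h⟩

/-- On `p`-almost every path a locally `p`-integrable function has finite integral. -/
lemma LocallyPIntegrable.exists_density [BorelSpace X] [ProperSpace X] (hp : 0 < p)
    {g : X → ENNReal} (hg : LocallyPIntegrable p μ g) (hm : Measurable g) :
    ∃ ρ : X → ENNReal, Measurable ρ ∧ ∫⁻ x, ρ x ^ p ∂μ ≠ ⊤ ∧
      ∀ γ : RectifiablePath X, γ.pathIntegral ρ ≠ ⊤ → γ.pathIntegral g ≠ ⊤ := by
  rcases isEmpty_or_nonempty X with hX | ⟨⟨x₀⟩⟩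
  · exact ⟨0, measurable_const, by simp [hp], fun γ => (hX.false (γ.toFun 0)).elim⟩
  obtain ⟨ρ, h1, h2, h3⟩ := exists_density_forall_pathIntegral_ne_top (μ := μ) hp
    (ρ := fun n : ℕ => (Metric.closedBall x₀ n).indicator g)
    (fun n => hm.indicator measurableSet_closedBall) (fun n => by
      have : ∀ x, (Metric.closedBall x₀ n).indicator g x ^ p =
          (Metric.closedBall x₀ n).indicator (fun x => g x ^ p) x := fun x => by
        by_cases hx : x ∈ Metric.closedBall x₀ n <;> simp [hx, hp]
      simp_rw [this]
      rw [lintegral_indicator measurableSet_closedBall]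
      exact (hg.lintegral_lt_top (isCompact_closedBall x₀ n)).ne)
  refine ⟨ρ, h1, h2, fun γ hγ => ?_⟩
  obtain ⟨R, hR⟩ := ((isCompact_Icc.image_of_continuousOn γ.continuousOn_curve).isBounded).subset_closedBall x₀
  obtain ⟨n, hn⟩ := exists_nat_ge R
  convert h3 γ hγ n using 1
  refine setLIntegral_congr_fun measurableSet_Icc fun s hs => ?_
  have : γ.curve s ∈ Metric.closedBall x₀ n :=
    Metric.closedBall_subset_closedBall hn (hR ⟨s, hs, rfl⟩)
  exact (indicator_of_mem this g).symm

/-- The upper gradient inequality holds on all subpaths of `γ`, with a finite integral. -/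
def GoodPath (g : X → ENNReal) (u : X → EReal) (γ : RectifiablePath X) : Prop :=
  γ.pathIntegral g ≠ ⊤ ∧ ∀ s t, 0 ≤ s → s < t → t ≤ γ.length →
    (u (γ.curve s) - u (γ.curve t)).abs ≤ ∫⁻ r in Icc s t, g (γ.curve r)

/-- A subpath of a path with finite `ρ`-integral again has finite `ρ`-integral, so no subpath is
exceptional. -/
lemma IsWeakUpperGradient.exists_density_goodPath [BorelSpace X] [ProperSpace X] (hp : 0 < p)
    {g : X → ENNReal} {u : X → EReal} (h : IsWeakUpperGradient p μ g u)
    (hg : LocallyPIntegrable p μ g) :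
    ∃ ρ : X → ENNReal, Measurable ρ ∧ ∫⁻ x, ρ x ^ p ∂μ ≠ ⊤ ∧
      ∀ γ : RectifiablePath X, γ.pathIntegral ρ ≠ ⊤ → GoodPath g u γ := by
  obtain ⟨hm, ρ₁, a1, a2, a3⟩ := (isWeakUpperGradient_iff hp).1 h
  obtain ⟨ρ₂, b1, b2, b3⟩ := hg.exists_density hp hm
  obtain ⟨σ, c1, c2, c3⟩ := exists_density_pathIntegral_ne_top_and hp a1 b1 a2 b2
  refine ⟨σ, c1, c2, fun γ hγ => ⟨b3 γ (c3 γ hγ).2, fun s t hs hst ht => ?_⟩⟩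
  have := a3 (γ.sub hs hst ht) (by
    rw [γ.pathIntegral_sub]
    exact ne_top_of_le_ne_top (c3 γ hγ).1 (lintegral_mono_set (Icc_subset_Icc hs ht)))
  rwa [UpperGradientIneq, γ.pathIntegral_sub] at this

lemma ne_top_of_abs_sub_ne_top {x y : EReal} (h : (x - y).abs ≠ ⊤) :
    (x ≠ ⊤ ∧ x ≠ ⊥) ∧ (y ≠ ⊤ ∧ y ≠ ⊥) := by
  induction x <;> induction y <;> simp_all

lemma abs_sub_eq_ofReal {x y : EReal} (hx : x ≠ ⊤) (hx' : x ≠ ⊥) (hy : y ≠ ⊤) (hy' : y ≠ ⊥) :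
    (x - y).abs = ENNReal.ofReal |x.toReal - y.toReal| := by
  lift x to ℝ using ⟨hx, hx'⟩
  lift y to ℝ using ⟨hy, hy'⟩
  rw [← EReal.coe_sub, EReal.abs_def]
  simp

namespace GoodPath

variable {g : X → ENNReal} {u : X → EReal} {γ : RectifiablePath X}

lemma finite (h : GoodPath g u γ) {s : ℝ} (hs : s ∈ Icc 0 γ.length) :
    u (γ.curve s) ≠ ⊤ ∧ u (γ.curve s) ≠ ⊥ := by
  have key : ∀ s t, 0 ≤ s → s < t → t ≤ γ.length → (u (γ.curve s) - u (γ.curve t)).abs ≠ ⊤ :=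
    fun s t hs hst ht => ne_top_of_le_ne_top h.1
      ((h.2 s t hs hst ht).trans (lintegral_mono_set (Icc_subset_Icc hs ht)))
  rcases eq_or_lt_of_le hs.2 with h' | h'
  · rw [h']
    exact (ne_top_of_abs_sub_ne_top (key 0 γ.length le_rfl γ.length_pos le_rfl)).2
  · exact (ne_top_of_abs_sub_ne_top (key s γ.length hs.1 h' le_rfl)).1

lemma incrementBound (h : GoodPath g u γ) :
    IncrementBound (fun s => (u (γ.curve s)).toReal) (fun s => g (γ.curve s)) 0 γ.length := by
  intro s t hs hst ht
  have h1 := h.finite ⟨hs, hst.le.trans ht⟩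
  have h2 := h.finite ⟨hs.trans hst.le, ht⟩
  have := h.2 s t hs hst ht
  rwa [abs_sub_eq_ofReal h1.1 h1.2 h2.1 h2.2] at this

end GoodPath

lemma RectifiablePath.aemeasurable_comp_curve [BorelSpace X] (γ : RectifiablePath X)
    {g : X → ENNReal} (hg : Measurable g) :
    AEMeasurable (fun s => g (γ.curve s)) (volume.restrict (Icc 0 γ.length)) :=
  hg.comp_aemeasurable (γ.continuousOn_curve.aemeasurable measurableSet_Icc)

lemma upperGradientIneq_of_incrementBound {h : X → ENNReal} {v : X → EReal} {γ : RectifiablePath X}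
    (hfin : ∀ s ∈ Icc 0 γ.length, v (γ.curve s) ≠ ⊤ ∧ v (γ.curve s) ≠ ⊥)
    (hb : IncrementBound (fun s => (v (γ.curve s)).toReal) (fun s => h (γ.curve s)) 0 γ.length) :
    UpperGradientIneq h v γ := by
  have h1 := hfin 0 ⟨le_rfl, γ.length_pos.le⟩
  have h2 := hfin γ.length ⟨γ.length_pos.le, le_rfl⟩
  rw [UpperGradientIneq, ← γ.curve_zero, ← γ.curve_length, abs_sub_eq_ofReal h1.1 h1.2 h2.1 h2.2]
  exact hb 0 γ.length le_rfl γ.length_pos le_rfl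

end MetricNewtonian
end

/-! ### Lattice operations, chain rule and minimal weak upper gradients. -/

noncomputable section

namespace MetricNewtonian

variable {X : Type*} [MetricSpace X] [MeasurableSpace X] [BorelSpace X] {p : ℝ} {μ : Measure X}

lemma LocallyPIntegrable.mono {g h : X → ENNReal} (hp : 0 ≤ p) (hg : LocallyPIntegrable p μ g)
    (hle : ∀ x, h x ≤ g x) : LocallyPIntegrable p μ h := by
  intro x
  obtain ⟨U, hU, hx, hfin⟩ := hg x
  exact ⟨U, hU, hx, (lintegral_mono fun y => ENNReal.rpow_le_rpow (hle y) hp).trans_lt hfin⟩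

/-- A null set meets `p`-almost every path in zero length. -/
lemma ae_curve_notMem_of_pathIntegral_ne_top {N : Set X} (hN : MeasurableSet N)
    {γ : RectifiablePath X} (h : γ.pathIntegral (N.indicator fun _ => ⊤) ≠ ⊤) :
    ∀ᵐ s, s ∈ Icc 0 γ.length → γ.curve s ∉ N := by
  rw [γ.pathIntegral_eq] at h
  have := ae_lt_top' (γ.aemeasurable_comp_curve (measurable_const.indicator hN)) h
  rw [ae_restrict_iff' measurableSet_Icc] at this
  filter_upwards [this] with s hs hmem hsN
  simpa [hsN] using hs hmem

/-- On a good path both functions bound the same derivative a.e., so their minimum does too;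
integrate back. -/
lemma IsWeakUpperGradient.min [ProperSpace X] (hp : 0 < p) {g₁ g₂ : X → ENNReal} {u : X → EReal}
    (h₁ : IsWeakUpperGradient p μ g₁ u) (l₁ : LocallyPIntegrable p μ g₁)
    (h₂ : IsWeakUpperGradient p μ g₂ u) (l₂ : LocallyPIntegrable p μ g₂) :
    IsWeakUpperGradient p μ (fun x => min (g₁ x) (g₂ x)) u := by
  obtain ⟨ρ₁, a1, a2, a3⟩ := h₁.exists_density_goodPath hp l₁
  obtain ⟨ρ₂, b1, b2, b3⟩ := h₂.exists_density_goodPath hp l₂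
  obtain ⟨σ, c1, c2, c3⟩ := exists_density_pathIntegral_ne_top_and hp a1 b1 a2 b2
  refine (isWeakUpperGradient_iff hp).2 ⟨h₁.1.min h₂.1, σ, c1, c2, fun γ hγ => ?_⟩
  have G₁ := a3 γ (c3 γ hγ).1
  have G₂ := b3 γ (c3 γ hγ).2
  have m₁ := γ.aemeasurable_comp_curve h₁.1
  have m₂ := γ.aemeasurable_comp_curve h₂.1
  refine upperGradientIneq_of_incrementBound (fun s hs => G₁.finite hs) ?_
  refine incrementBound_of_ae_abs_deriv_le
    (G₁.incrementBound.absolutelyContinuous γ.length_pos.le m₁ G₁.1) ?_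
  filter_upwards [G₁.incrementBound.ae_abs_deriv_le γ.length_pos.le m₁ G₁.1,
    G₂.incrementBound.ae_abs_deriv_le γ.length_pos.le m₂ G₂.1] with s h1 h2 hs
  exact le_min (h1 hs).2 (h2 hs).2

/-- Monotone convergence for decreasing sequences along each path; the integral of `g 0` there is
finite. -/
lemma IsWeakUpperGradient.iInf [ProperSpace X] (hp : 0 < p) {g : ℕ → X → ENNReal} {u : X → EReal}
    (h : ∀ n, IsWeakUpperGradient p μ (g n) u) (hanti : Antitone g)
    (hl : LocallyPIntegrable p μ (g 0)) :
    IsWeakUpperGradient p μ (fun x => ⨅ n, g n x) u := by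
  have hd := fun n => (h n).exists_density_goodPath hp (hl.mono hp.le (hanti (Nat.zero_le n)))
  choose ρ a1 a2 a3 using hd
  obtain ⟨σ, c1, c2, c3⟩ := exists_density_forall_pathIntegral_ne_top hp a1 a2
  refine (isWeakUpperGradient_iff hp).2 ⟨Measurable.iInf fun n => (h n).1, σ, c1, c2, fun γ hγ => ?_⟩
  have G := fun n => a3 n γ (c3 γ hγ n)
  have heq : γ.pathIntegral (fun x => ⨅ n, g n x) = ⨅ n, γ.pathIntegral (g n) := by
    simp only [γ.pathIntegral_eq]
    exact lintegral_iInf' (fun n => γ.aemeasurable_comp_curve (h n).1)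
      (Filter.Eventually.of_forall fun s m n hmn => hanti hmn _) (G 0).1
  rw [UpperGradientIneq, heq]
  refine le_iInf fun n => ?_
  have := (G n).2 0 γ.length le_rfl γ.length_pos le_rfl
  rwa [γ.curve_zero, γ.curve_length] at this

/-- The chain rule for a function `Φ(u, η)` of `u` and of a Lipschitz function `η`. -/
lemma IsWeakUpperGradient.chain [ProperSpace X] (hp : 0 < p) {g h : X → ENNReal} {u v : X → EReal}
    {η : X → ℝ} {K M : NNReal} {Φ : ℝ × ℝ → ℝ} {A B : ℝ × ℝ → ℝ}
    (hg : IsWeakUpperGradient p μ g u) (hl : LocallyPIntegrable p μ g) (hu : ∀ x, 0 < u x)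
    (hη : LipschitzWith K η) (hη01 : ∀ x, η x ∈ Icc (0 : ℝ) 1)
    (hΦ : LipschitzOnWith M Φ (Ioi 0 ×ˢ Icc 0 1))
    (hΦ' : ∀ z ∈ Ioi (0 : ℝ) ×ˢ Icc (0 : ℝ) 1, HasFDerivAt Φ
      (A z • ContinuousLinearMap.fst ℝ ℝ ℝ + B z • ContinuousLinearMap.snd ℝ ℝ ℝ) z)
    (hv : ∀ x, u x ≠ ⊤ → v x = (Φ ((u x).toReal, η x) : ℝ)) (hm : Measurable h)
    (hle : ∀ᵐ x ∂μ, ENNReal.ofReal |A ((u x).toReal, η x)| * g x +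
      ENNReal.ofReal |B ((u x).toReal, η x)| * K ≤ h x) :
    IsWeakUpperGradient p μ h v := by
  -- The bound by `h` fails only on a null set `N`. The density `∞ · 1_N` has zero energy, and it
  -- discards the paths that spend positive length in `N`.
  obtain ⟨N, hNsub, hN, hN0⟩ := exists_measurable_superset_of_null (ae_iff.1 hle)
  obtain ⟨ρ, a1, a2, a3⟩ := hg.exists_density_goodPath hp hl
  obtain ⟨σ, c1, c2, c3⟩ := exists_density_pathIntegral_ne_top_and (μ := μ) hp a1
    (measurable_const.indicator hN) a2 (ρ₂ := N.indicator fun _ => ⊤) (by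
      rw [lintegral_eq_zero_iff ((measurable_const.indicator hN).pow_const p) |>.2]
      · simp
      · filter_upwards [compl_mem_ae_iff.2 hN0] with x hx
        simp [indicator_of_notMem (show x ∉ N from hx), hp])
  refine (isWeakUpperGradient_iff hp).2 ⟨hm, σ, c1, c2, fun γ hγ => ?_⟩
  have G := a3 γ (c3 γ hγ).1
  have hNae := ae_curve_notMem_of_pathIntegral_ne_top hN (c3 γ hγ).2
  have hL := γ.length_pos.le
  have mg := γ.aemeasurable_comp_curve hg.1
  set w : ℝ → ℝ := fun s => (u (γ.curve s)).toReal with hw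
  set e : ℝ → ℝ := fun s => η (γ.curve s) with he
  have hwpos : ∀ s ∈ Icc 0 γ.length, 0 < w s := fun s hs =>
    EReal.toReal_pos (hu _) (G.finite hs).1
  have hmem : ∀ s ∈ Icc 0 γ.length, (w s, e s) ∈ Ioi (0 : ℝ) ×ˢ Icc (0 : ℝ) 1 := fun s hs =>
    ⟨hwpos s hs, hη01 _⟩
  have hveq : ∀ s ∈ Icc 0 γ.length, v (γ.curve s) = (Φ (w s, e s) : ℝ) := fun s hs =>
    hv _ (G.finite hs).1
  have hwb : IncrementBound w (fun s => g (γ.curve s)) 0 γ.length := G.incrementBound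
  have heb : IncrementBound e (fun _ => (K : ENNReal)) 0 γ.length := by
    intro s t hs hst ht
    rw [setLIntegral_const, Real.volume_Icc, ← Real.dist_eq, ← edist_dist]
    have h1 := (hη.comp_lipschitzOnWith γ.lipschitzOnWith_curve) ⟨hs, hst.le.trans ht⟩
      ⟨hs.trans hst.le, ht⟩
    rw [mul_one, edist_comm s, edist_dist t, Real.dist_eq, abs_of_pos (sub_pos.2 hst)] at h1
    exact h1
  have hGfin : ∫⁻ s in Icc 0 γ.length, M * (g (γ.curve s) + K) ≠ ⊤ := by
    rw [lintegral_const_mul' _ _ ENNReal.coe_ne_top, lintegral_add_right _ measurable_const]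
    refine ENNReal.mul_ne_top ENNReal.coe_ne_top (ENNReal.add_ne_top.2 ⟨G.1, ?_⟩)
    rw [setLIntegral_const, Real.volume_Icc]
    exact ENNReal.mul_ne_top ENNReal.coe_ne_top ENNReal.ofReal_ne_top
  -- This crude Lipschitz bound only serves to give absolute continuity; the sharp derivative bound
  -- follows from the chain rule.
  have hΦb : IncrementBound (fun s => Φ (w s, e s)) (fun s => M * (g (γ.curve s) + K)) 0
      γ.length := by
    intro s t hs hst ht
    rw [lintegral_const_mul' _ _ ENNReal.coe_ne_top, lintegral_add_right _ measurable_const,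
      ← Real.dist_eq, ← edist_dist]
    refine (hΦ (hmem s ⟨hs, hst.le.trans ht⟩) (hmem t ⟨hs.trans hst.le, ht⟩)).trans ?_
    gcongr
    rw [Prod.edist_eq]
    refine max_le ?_ ?_
    · rw [edist_dist, Real.dist_eq]
      exact (hwb s t hs hst ht).trans le_self_add
    · rw [edist_dist, Real.dist_eq]
      exact (heb s t hs hst ht).trans le_add_self
  have hΦac := hΦb.absolutelyContinuous hL ((mg.add_const _).const_mul _) hGfin
  have hKfin : ∫⁻ _ in Icc 0 γ.length, (K : ENNReal) ≠ ⊤ := by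
    rw [setLIntegral_const, Real.volume_Icc]
    exact ENNReal.mul_ne_top ENNReal.coe_ne_top ENNReal.ofReal_ne_top
  have hb : IncrementBound (fun s => Φ (w s, e s)) (fun s => h (γ.curve s)) 0 γ.length := by
    refine incrementBound_of_ae_abs_deriv_le hΦac ?_
    filter_upwards [hwb.ae_abs_deriv_le hL mg G.1, heb.ae_abs_deriv_le hL aemeasurable_const hKfin,
      hNae] with s h1 h2 h3 hs
    obtain ⟨d1, b1⟩ := h1 hs
    obtain ⟨d2, b2⟩ := h2 hs
    have hx := not_not.1 fun hc => h3 hs (hNsub hc)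
    have hd := (hΦ' _ (hmem s hs)).comp_hasDerivAt s (d1.hasDerivAt.prodMk d2.hasDerivAt)
    have hd' : deriv (fun s => Φ (w s, e s)) s = A (w s, e s) * deriv w s + B (w s, e s) * deriv e s := by
      have := hd.deriv
      simpa [Function.comp_def] using this
    rw [hd']
    refine le_trans ?_ hx
    calc ENNReal.ofReal |A (w s, e s) * deriv w s + B (w s, e s) * deriv e s|
        ≤ ENNReal.ofReal (|A (w s, e s)| * |deriv w s| + |B (w s, e s)| * |deriv e s|) := by
          refine ENNReal.ofReal_le_ofReal ((abs_add_le _ _).trans_eq ?_)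
          rw [abs_mul, abs_mul]
      _ = ENNReal.ofReal |A (w s, e s)| * ENNReal.ofReal |deriv w s| +
          ENNReal.ofReal |B (w s, e s)| * ENNReal.ofReal |deriv e s| := by
          rw [ENNReal.ofReal_add (by positivity) (by positivity), ENNReal.ofReal_mul (abs_nonneg _),
            ENNReal.ofReal_mul (abs_nonneg _)]
      _ ≤ _ := by gcongr
  refine upperGradientIneq_of_incrementBound (fun s hs => ?_) fun s t hs hst ht => ?_
  · rw [hveq s hs]
    exact ⟨EReal.coe_ne_top _, EReal.coe_ne_bot _⟩
  · beta_reduce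
    rw [hveq s ⟨hs, hst.le.trans ht⟩, hveq t ⟨hs.trans hst.le, ht⟩]
    exact hb s t hs hst ht

lemma IsUpperGradient.isWeakUpperGradient (hp : 0 < p) {g : X → ENNReal} {u : X → EReal}
    (h : IsUpperGradient g u) : IsWeakUpperGradient p μ g u :=
  (isWeakUpperGradient_iff hp).2 ⟨h.1, 0, measurable_const, by simp [hp],
    fun γ _ => h.2 γ fun _ _ => mem_univ _⟩

/-- Adding a density of the exceptional family turns a weak upper gradient into an upper gradient. -/
lemma IsWeakUpperGradient.exists_isUpperGradient (hp : 1 ≤ p) {g : X → ENNReal} {u : X → EReal}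
    (h : IsWeakUpperGradient p μ g u) (hfin : ∫⁻ x, g x ^ p ∂μ < ⊤) :
    ∃ g' : X → ENNReal, IsUpperGradient g' u ∧ ∫⁻ x, g' x ^ p ∂μ < ⊤ := by
  obtain ⟨hm, ρ, a1, a2, a3⟩ := (isWeakUpperGradient_iff (zero_lt_one.trans_le hp)).1 h
  refine ⟨g + ρ, ⟨hm.add a1, fun γ _ => ?_⟩,
    ENNReal.lintegral_rpow_add_lt_top_of_lintegral_rpow_lt_top hm.aemeasurable hfin a2.lt_top hp⟩
  rw [UpperGradientIneq]
  by_cases hγ : γ.pathIntegral ρ = ⊤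
  · refine le_top.trans (hγ.symm.trans_le ?_)
    exact lintegral_mono fun s => le_add_self
  · exact (a3 γ hγ).trans (lintegral_mono fun s => le_self_add)

/-- Existence of minimal weak upper gradients. -/
lemma exists_isMinimalWeakUpperGradient [ProperSpace X] [SFinite μ] (hp : 0 < p) {g : X → ENNReal}
    {u : X → EReal} (hg : IsWeakUpperGradient p μ g u) (hl : LocallyPIntegrable p μ g) :
    ∃ g₀ : X → ENNReal, IsMinimalWeakUpperGradient p μ g₀ u := by
  set ν := μ.toFinite with hν
  set S : Set (X → ENNReal) := {h | IsWeakUpperGradient p μ h u ∧ LocallyPIntegrable p μ h}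
  -- A finite functional, strictly decreasing in `h` modulo null sets. A maximizer over `S`, which
  -- is closed under minima and decreasing limits, is then minimal a.e. The finite measure `ν` has
  -- the null sets of `μ`.
  set J : (X → ENNReal) → ENNReal := fun h => ∫⁻ x, (1 + h x)⁻¹ ∂ν with hJ
  have hJle : ∀ h, J h ≤ ν univ := fun h => by
    refine (lintegral_mono (g := fun _ => 1) fun x => ?_).trans_eq (by simp)
    exact ENNReal.inv_le_one.2 le_self_add
  have hJanti : ∀ h h' : X → ENNReal, (∀ x, h x ≤ h' x) → J h' ≤ J h := fun h h' hle =>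
    lintegral_mono fun x => ENNReal.inv_le_inv.2 (by gcongr; exact hle x)
  obtain ⟨a, -, ha, haS⟩ := (exists_seq_tendsto_sSup (S := J '' S) ⟨_, g, ⟨hg, hl⟩, rfl⟩
    (OrderTop.bddAbove _))
  choose f hfS hfa using haS
  -- Running minima turn the maximizing sequence into a decreasing one that still lies in `S`.
  set F : ℕ → X → ENNReal := fun n => Nat.rec (f 0) (fun n h x => min (h x) (f (n + 1) x)) n with hF
  have hFsucc : ∀ n x, F (n + 1) x = min (F n x) (f (n + 1) x) := fun n x => rfl
  have hFS : ∀ n, F n ∈ S := by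
    intro n
    induction n with
    | zero => exact hfS 0
    | succ n ih =>
      exact ⟨ih.1.min hp ih.2 (hfS _).1 (hfS _).2, ih.2.mono hp.le fun x => min_le_left _ _⟩
  have hFanti : Antitone F := antitone_nat_of_succ_le fun n x => min_le_left _ _
  have hFf : ∀ n x, F n x ≤ f n x := fun n x => by
    cases n with
    | zero => exact le_rfl
    | succ n => exact min_le_right _ _
  set G : X → ENNReal := fun x => ⨅ n, F n x with hG
  have hGw : IsWeakUpperGradient p μ G u := IsWeakUpperGradient.iInf hp (fun n => (hFS n).1) hFanti
    (hFS 0).2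
  have hGl : LocallyPIntegrable p μ G := (hFS 0).2.mono hp.le fun x => iInf_le _ 0
  have hsup : ∀ h ∈ S, J h ≤ J G := by
    intro h hh
    refine (le_sSup (mem_image_of_mem J hh)).trans (le_of_tendsto' ha fun n => ?_)
    rw [← hfa n]
    exact hJanti _ _ fun x => (iInf_le _ n).trans (hFf n x)
  refine ⟨G, hGw, hGl, fun h hh hhl => ?_⟩
  have hmin : J (fun x => min (G x) (h x)) ≤ J G :=
    hsup _ ⟨hGw.min hp hGl hh hhl, hGl.mono hp.le fun x => min_le_left _ _⟩
  -- Replacing `G` by `min G h` cannot increase `J` further, so the two integrands agree a.e. and `G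
  -- ≤ h`.
  have hae := ae_eq_of_ae_le_of_lintegral_le (μ := ν) (f := fun x => (1 + G x)⁻¹)
    (g := fun x => (1 + min (G x) (h x))⁻¹)
    (Filter.Eventually.of_forall fun x => ENNReal.inv_le_inv.2 (by gcongr; exact min_le_left _ _))
    (ne_top_of_le_ne_top (measure_ne_top ν univ) (hJle G))
    (by exact ((hGw.1.min hh.1).const_add 1).inv.aemeasurable) hmin
  have hae' := (absolutelyContinuous_toFinite μ).ae_le hae
  filter_upwards [hae'] with x hx
  rw [inv_inj] at hx
  have := (ENNReal.add_right_inj ENNReal.one_ne_top).1 hx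
  exact this.trans_le (min_le_right _ _)

end MetricNewtonian
end

/-! ### Gluing local upper gradients; properness of doubling spaces. -/

noncomputable section

namespace MetricNewtonian

variable {X : Type*} [MetricSpace X] [MeasurableSpace X] [BorelSpace X] {p : ℝ} {μ : Measure X}

lemma abs_sub_le_add (x y z : EReal) : (x - z).abs ≤ (x - y).abs + (y - z).abs := by
  by_cases h1 : (x - y).abs = ⊤
  · simp [h1]
  by_cases h2 : (y - z).abs = ⊤
  · simp [h2]
  obtain ⟨⟨a1, a2⟩, b1, b2⟩ := ne_top_of_abs_sub_ne_top h1
  obtain ⟨-, c1, c2⟩ := ne_top_of_abs_sub_ne_top h2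
  rw [abs_sub_eq_ofReal a1 a2 c1 c2, abs_sub_eq_ofReal a1 a2 b1 b2, abs_sub_eq_ofReal b1 b2 c1 c2,
    ← ENNReal.ofReal_add (abs_nonneg _) (abs_nonneg _)]
  exact ENNReal.ofReal_le_ofReal (abs_sub_le _ _ _)

/-- A function which is an upper gradient in each set of an open cover is an upper gradient. -/
lemma isUpperGradient_of_open_cover {ι : Type*} {V : ι → Set X} (hV : ∀ i, IsOpen (V i))
    (hcov : ⋃ i, V i = univ) {g : X → ENNReal} {u : X → EReal} (hm : Measurable g)
    (h : ∀ i, ∀ γ : RectifiablePath X, (∀ t ∈ Icc γ.a γ.b, γ.toFun t ∈ V i) →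
      UpperGradientIneq g u γ) : IsUpperGradient g u := by
  refine ⟨hm, fun γ _ => ?_⟩
  have hL := γ.length_pos
  have hcont : Continuous fun s : Icc 0 γ.length => γ.curve s :=
    continuousOn_iff_continuous_domRestrict.1 γ.continuousOn_curve
  -- Subdivide the path into finitely many pieces, each inside one set of the cover, and add up. The
  -- subdivision is only weakly monotone, so trivial pieces are treated separately.
  obtain ⟨t, ht0, hmono, ⟨m, hm'⟩, hsub⟩ := exists_monotone_Icc_subset_open_cover_Icc hL.le
    (c := fun i => (fun s : Icc 0 γ.length => γ.curve s) ⁻¹' V i)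
    (fun i => (hV i).preimage hcont) (fun s _ => by
      have : γ.curve s ∈ ⋃ i, V i := hcov ▸ mem_univ _
      simpa using this)
  have piece : ∀ n, (t n : ℝ) < t (n + 1) → (u (γ.curve (t n)) - u (γ.curve (t (n + 1)))).abs ≤
      ∫⁻ r in Icc (t n : ℝ) (t (n + 1)), g (γ.curve r) := by
    intro n hn
    obtain ⟨i, hi⟩ := hsub n
    have := h i (γ.sub (t n).2.1 hn (t (n + 1)).2.2) fun r hr => by
      have hr' : r ∈ Icc (t n : ℝ) (t (n + 1)) := hr
      exact hi (show (⟨r, (t n).2.1.trans hr'.1, hr'.2.trans (t (n + 1)).2.2⟩ : Icc 0 γ.length) ∈ _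
        from ⟨hr'.1, hr'.2⟩)
    rwa [UpperGradientIneq, γ.pathIntegral_sub] at this
  have main : ∀ n, (0 : ℝ) < t n → (u (γ.curve 0) - u (γ.curve (t n))).abs ≤
      ∫⁻ r in Icc (0 : ℝ) (t n), g (γ.curve r) := by
    intro n
    induction n with
    | zero => intro h0; rw [ht0] at h0; exact absurd h0 (lt_irrefl _)
    | succ n ih =>
      intro hpos
      have hle : (t n : ℝ) ≤ t (n + 1) := hmono (Nat.le_succ n)
      rcases hle.eq_or_lt with heq | hlt
      · rw [← heq] at hpos ⊢; exact ih hpos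
      · rcases (t n).2.1.eq_or_lt with h0 | h0
        · have := piece n hlt
          rwa [← h0] at this
        · refine (abs_sub_le_add _ (u (γ.curve (t n))) _).trans
            ((add_le_add (ih h0) (piece n hlt)).trans ?_)
          rw [setLIntegral_congr (μ := volume) (Ioc_ae_eq_Icc (a := (t n : ℝ))).symm,
            ← lintegral_union measurableSet_Ioc, Icc_union_Ioc_eq_Icc h0.le hle]
          exact Set.disjoint_left.2 fun x hx hx' => not_lt.2 hx.2 hx'.1
  have hend : (t m : ℝ) = γ.length := by rw [hm' m le_rfl]
  have := main m (by rw [hend]; exact hL)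
  rw [hend] at this
  rwa [UpperGradientIneq, ← γ.curve_zero, ← γ.curve_length]

/-- A function in the local Newtonian space is measurable and finite a.e., and has a locally
`p`-integrable upper gradient. -/
lemma MemNewtonianLoc.exists_isUpperGradient [SecondCountableTopology X] (hp : 0 < p)
    {u : X → EReal} (h : MemNewtonianLoc p μ u) :
    AEMeasurable u μ ∧ (∀ᵐ x ∂μ, u x ≠ ⊤) ∧
      ∃ g : X → ENNReal, IsUpperGradient g u ∧ LocallyPIntegrable p μ g := by
  choose U hU hxU hN using h
  obtain ⟨s, hs, hcov⟩ := TopologicalSpace.countable_cover_nhds fun x => (hU x).mem_nhds (hxU x)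
  have : Countable s := hs.to_subtype
  have hcov' : ⋃ i : s, U i = univ := by rw [← hcov, biUnion_eq_iUnion]
  refine ⟨?_, ?_, ?_⟩
  · rw [← Measure.restrict_univ (μ := μ), ← hcov', aemeasurable_iUnion_iff]
    exact fun i => (hN i).1
  · rw [← Measure.restrict_univ (μ := μ), ← hcov', ae_restrict_iUnion_iff]
    intro i
    have hme : AEMeasurable (fun x => (u x).abs ^ p) (μ.restrict (U i)) := by
      have : Measurable EReal.abs := by
        refine EReal.measurable_of_measurable_real ?_
        exact ENNReal.measurable_ofReal.comp measurable_norm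
      exact (this.comp_aemeasurable (hN i).1).pow_const p
    filter_upwards [ae_lt_top' hme (hN i).2.1.ne] with x hx hxt
    simp [hxt, hp] at hx
  · choose g hg hgfin using fun i : s => (hN i).2.2
    -- Local finiteness makes the supremum below locally a supremum of finitely many `p`-integrable
    -- functions.
    obtain ⟨V, hV, hVcov, hVfin, hVU⟩ := precise_refinement (fun i : s => U i) (fun i => hU i) hcov'
    set G : X → ENNReal := fun x => ⨆ i, (V i).indicator (g i) x with hG
    have hGm : Measurable G := Measurable.iSup fun i => (hg i).1.indicator (hV i).measurableSet
    refine ⟨G, isUpperGradient_of_open_cover hV hVcov hGm fun i γ hγ => ?_, fun x => ?_⟩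
    · refine ((hg i).2 γ fun t ht => hVU i (hγ t ht)).trans
        (setLIntegral_mono_ae' measurableSet_Icc (Filter.Eventually.of_forall fun r hr => ?_))
      obtain ⟨t, ht, heq⟩ := γ.exists_curve_eq hr
      have hmem : γ.curve r ∈ V i := heq ▸ hγ t ht
      change g i (γ.curve r) ≤ ⨆ i, (V i).indicator (g i) (γ.curve r)
      refine le_trans ?_ (le_iSup (fun i => (V i).indicator (g i) (γ.curve r)) i)
      rw [indicator_of_mem hmem]
    · obtain ⟨W, hW, hWfin⟩ := hVfin x
      obtain ⟨W', hW'W, hW'o, hxW'⟩ := mem_nhds_iff.1 hW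
      refine ⟨W', hW'o, hxW', ?_⟩
      have hle : ∀ y ∈ W', G y ^ p ≤ ∑ i ∈ hWfin.toFinset, (U i).indicator (fun y => g i y ^ p) y := by
        intro y hy
        rw [← ENNReal.le_rpow_inv_iff hp]
        refine iSup_le fun i => ?_
        rw [ENNReal.le_rpow_inv_iff hp]
        by_cases hyi : y ∈ V i
        · rw [indicator_of_mem hyi]
          have hi : i ∈ hWfin.toFinset := by
            rw [Set.Finite.mem_toFinset]; exact ⟨y, hyi, hW'W hy⟩
          refine le_trans ?_ (Finset.single_le_sum (fun _ _ => zero_le) hi)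
          rw [indicator_of_mem (hVU i hyi)]
        · simp [hyi, hp]
      calc ∫⁻ y in W', G y ^ p ∂μ
          ≤ ∫⁻ y in W', ∑ i ∈ hWfin.toFinset, (U i).indicator (fun y => g i y ^ p) y ∂μ :=
            setLIntegral_mono_ae' hW'o.measurableSet (Filter.Eventually.of_forall hle)
        _ ≤ ∫⁻ y, ∑ i ∈ hWfin.toFinset, (U i).indicator (fun y => g i y ^ p) y ∂μ :=
            setLIntegral_le_lintegral _ _
        _ = ∑ i ∈ hWfin.toFinset, ∫⁻ y in U i, g i y ^ p ∂μ := by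
            rw [lintegral_finsetSum _ fun i _ =>
              ((hg i).1.pow_const p).indicator (hU i).measurableSet]
            exact Finset.sum_congr rfl fun i _ => lintegral_indicator (hU i).measurableSet _
        _ < ⊤ := ENNReal.sum_lt_top.2 fun i _ => hgfin i

namespace IsDoublingWith

variable {C : ℝ}

lemma measure_ball_lt_top (h : IsDoublingWith μ C) (x : X) (r : ℝ) : μ (Metric.ball x r) < ⊤ := by
  rcases le_or_gt r 0 with hr | hr
  · simp [Metric.ball_eq_empty.2 hr]
  · refine lt_of_le_of_lt ?_ (h.2 x r hr).2.2
    refine le_mul_of_one_le_left' ?_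
    rw [← ENNReal.ofReal_one]
    exact ENNReal.ofReal_le_ofReal h.1

lemma measure_ball_pos (h : IsDoublingWith μ C) (x : X) {r : ℝ} (hr : 0 < r) :
    0 < μ (Metric.ball x r) := by
  have := (h.2 x (r / 2) (by positivity)).1
  rwa [mul_div_cancel₀ _ two_ne_zero] at this

lemma measure_ball_two_pow_le (h : IsDoublingWith μ C) (x : X) {r : ℝ} (hr : 0 < r) (n : ℕ) :
    μ (Metric.ball x (2 ^ n * r)) ≤ ENNReal.ofReal C ^ n * μ (Metric.ball x r) := by
  induction n with
  | zero => simp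
  | succ n ih =>
    calc μ (Metric.ball x (2 ^ (n + 1) * r)) = μ (Metric.ball x (2 * (2 ^ n * r))) := by ring_nf
      _ ≤ ENNReal.ofReal C * μ (Metric.ball x (2 ^ n * r)) := (h.2 x _ (by positivity)).2.1
      _ ≤ ENNReal.ofReal C * (ENNReal.ofReal C ^ n * μ (Metric.ball x r)) := by gcongr
      _ = _ := by ring

/-- In a doubling space balls are totally bounded. -/
lemma totallyBounded_closedBall (h : IsDoublingWith μ C) (x₀ : X) (R : ℝ) :
    TotallyBounded (Metric.closedBall x₀ R) := by
  rw [Metric.totallyBounded_iff]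
  intro ε hε
  obtain ⟨n, hn⟩ := pow_unbounded_of_one_lt ((2 * |R| + ε) / (ε / 2)) one_lt_two
  have hC : 0 < ENNReal.ofReal C := ENNReal.ofReal_pos.2 (zero_lt_one.trans_le h.1)
  -- Iterated doubling: `n` is large enough that `B(y, 2^n ε/2)` contains `B(x₀, |R| + ε)` for every
  -- `y` in the ball, so `c` bounds all `μ (B(y, ε/2))` from below.
  set c : ENNReal := μ (Metric.ball x₀ (|R| + ε)) / ENNReal.ofReal C ^ n with hc
  have hlow : ∀ y ∈ Metric.closedBall x₀ R, c / 1 ≤ μ (Metric.ball y (ε / 2)) := by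
    intro y hy
    rw [div_one]
    refine ENNReal.div_le_of_le_mul' ?_
    refine le_trans (measure_mono ?_) (h.measure_ball_two_pow_le y (half_pos hε) n)
    refine Metric.ball_subset_ball' ?_
    rw [div_lt_iff₀ (half_pos hε)] at hn
    rw [dist_comm]
    linarith [Metric.mem_closedBall.1 hy, le_abs_self R]
  have hc0 : c ≠ 0 := ENNReal.div_ne_zero.2 ⟨(h.measure_ball_pos x₀ (by positivity)).ne',
    ENNReal.pow_ne_top ENNReal.ofReal_ne_top⟩
  -- A maximal set of centres with disjoint `ε/2`-balls: finite, by comparing measures, and an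
  -- `ε`-net, by maximality.
  obtain ⟨T, hT, hmax⟩ : ∃ T : Set X, Maximal (fun T => T ⊆ Metric.closedBall x₀ R ∧
      T.PairwiseDisjoint fun y => Metric.ball y (ε / 2)) T := by
    refine zorn_subset _ fun c hc hchain => ⟨⋃₀ c, ⟨sUnion_subset fun s hs => (hc hs).1, ?_⟩,
      fun s hs => subset_sUnion_of_mem hs⟩
    exact (pairwiseDisjoint_sUnion hchain.directedOn).2 fun s hs => (hc hs).2
  refine ⟨T, ?_, fun y hy => ?_⟩
  · have hfin := Measure.finite_const_le_meas_of_disjoint_iUnion (μ := μ.restrict (Metric.ball x₀ (|R| + ε)))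
      (ε := c) (pos_iff_ne_zero.2 hc0) (As := fun y : T => Metric.ball (y : X) (ε / 2))
      (fun y => Metric.isOpen_ball.measurableSet)
      (fun y z hyz => hT.2 y.2 z.2 fun h => hyz (Subtype.ext h))
      (by
        refine ((measure_mono (subset_univ _)).trans_lt ?_).ne
        rw [Measure.restrict_apply_univ]
        exact h.measure_ball_lt_top _ _)
    have : {y : T | c ≤ μ.restrict (Metric.ball x₀ (|R| + ε)) (Metric.ball (y : X) (ε / 2))} = univ := by
      refine eq_univ_of_forall fun y => ?_
      have hy := hT.1 y.2
      rw [mem_ofPred_eq, Measure.restrict_apply Metric.isOpen_ball.measurableSet,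
        inter_eq_self_of_subset_left]
      · simpa using hlow y hy
      · refine Metric.ball_subset_ball' ?_
        linarith [Metric.mem_closedBall.1 hy, le_abs_self R]
    rw [this] at hfin
    exact Set.finite_coe_iff.1 (Set.finite_univ_iff.1 hfin)
  · by_contra hcon
    simp only [mem_iUnion, Metric.mem_ball, not_exists, not_lt] at hcon
    have hins : insert y T ⊆ T := hmax ⟨insert_subset hy hT.1, by
      refine hT.2.insert fun z hz hne => ?_
      refine Metric.ball_disjoint_ball ?_
      linarith [hcon z hz]⟩ (subset_insert y T)
    have := hcon y (hins (mem_insert y T))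
    rw [dist_self] at this
    linarith

lemma properSpace [CompleteSpace X] (h : IsDoublingWith μ C) : ProperSpace X :=
  ⟨fun x r => (h.totallyBounded_closedBall x r).isCompact_of_isClosed Metric.isClosed_closedBall⟩

end IsDoublingWith

end MetricNewtonian
end

/-! ### Exponents, elementary inequalities, test and cutoff functions. -/

noncomputable section

namespace MetricNewtonian

/-- The admissible exponents for the test functions. -/
lemma exists_test_exponent {p δ δp m : ℝ} (hp : 2 ≤ p)
    (hδ : (p ^ 2 - 3 * p + 2) ^ 2 / (4 * (p - 1) ^ 2) < δ)
    (hδp : δp = (2 * δ + p - 1 + 2 * Real.sqrt (δ * (δ + p - 1))) / (p - 1))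
    (hm : m < p * (δ + δp) / (δ + p - 1)) :
    0 < δ ∧ ∃ α, p - 1 < α ∧ (p - 1) * ((α - 1) / 2) ^ 2 < δ * α ∧
      m < p * (δ + α) / (δ + p - 1) := by
  have hp1 : 0 < p - 1 := by linarith
  have hδ' : (p - 2) ^ 2 < 4 * δ := by
    rw [div_lt_iff₀ (by positivity), show p ^ 2 - 3 * p + 2 = (p - 2) * (p - 1) by ring] at hδ
    have h2 : 0 < (p - 1) ^ 2 := by positivity
    nlinarith
  have hδ0 : 0 < δ := by nlinarith [sq_nonneg (p - 2)]
  refine ⟨hδ0, ?_⟩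
  have hs : 0 < δ + p - 1 := by linarith
  set S := Real.sqrt (δ * (δ + p - 1)) with hS
  have hSsq : S ^ 2 = δ * (δ + p - 1) := Real.sq_sqrt (by positivity)
  have hSδ : δ ≤ S := Real.le_sqrt_of_sq_le (by nlinarith)
  -- The conjugate root: `δm` and `δp` are the zeros of `(p-1)(x-1)^2 - 4xδ`, and the required
  -- condition on `α` is that this quadratic be negative at `α`.
  set δm := (2 * δ + p - 1 - 2 * S) / (p - 1) with hδm
  have hδm1 : δm ≤ 1 := by rw [hδm, div_le_one hp1]; linarith
  have e1 : (p - 1) * δp = 2 * δ + p - 1 + 2 * S := by rw [hδp]; field_simp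
  have e2 : (p - 1) * δm = 2 * δ + p - 1 - 2 * S := by rw [hδm]; field_simp
  have hprod : (p - 1) * (δp * δm) = p - 1 := by
    have : (p - 1) * ((p - 1) * (δp * δm)) = (p - 1) * (p - 1) := by
      calc (p - 1) * ((p - 1) * (δp * δm)) = ((p - 1) * δp) * ((p - 1) * δm) := by ring
        _ = _ := by rw [e1, e2]; nlinarith
    exact mul_left_cancel₀ hp1.ne' this
  have hQ : ∀ x, (p - 1) * (x - 1) ^ 2 - 4 * x * δ = (p - 1) * ((x - δp) * (x - δm)) := by
    intro x
    have : (p - 1) * ((x - δp) * (x - δm)) =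
        (p - 1) * x ^ 2 - x * ((p - 1) * δp + (p - 1) * δm) + (p - 1) * (δp * δm) := by ring
    rw [this, e1, e2, hprod]; ring
  -- At `x = p-1` the quadratic equals `(p-1)((p-2)^2 - 4δ)`, negative by the hypothesis on `δ`.
  -- Since `δm ≤ 1 ≤ p-1`, the point `p-1` must lie below the larger root.
  have hlt : p - 1 < δp := by
    by_contra! hcon
    have h1 := hQ (p - 1)
    have h2 : 0 ≤ (p - 1) * ((p - 1 - δp) * (p - 1 - δm)) :=
      mul_nonneg hp1.le (mul_nonneg (by linarith) (by linarith))
    have h3 : (p - 1) * (p - 1 - 1) ^ 2 - 4 * (p - 1) * δ = (p - 1) * ((p - 2) ^ 2 - 4 * δ) := by ring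
    nlinarith
  have hα0 : (δ + p - 1) * m / p - δ < δp := by
    rw [lt_div_iff₀ hs] at hm
    rw [sub_lt_iff_lt_add, div_lt_iff₀ (by linarith)]
    linarith
  -- The second entry is the value of `α` at which `p(δ+α)/(δ+p-1)` equals `m`. Both lower bounds
  -- lie strictly below `δp`, so the midpoint is admissible.
  set α := (max (p - 1) ((δ + p - 1) * m / p - δ) + δp) / 2 with hα
  have hmax := max_lt hlt hα0
  have h1 : max (p - 1) ((δ + p - 1) * m / p - δ) < α := by rw [hα]; linarith
  have h2 : α < δp := by rw [hα]; linarith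
  have h3 : p - 1 < α := (le_max_left _ _).trans_lt h1
  have h4 : (δ + p - 1) * m / p - δ < α := (le_max_right _ _).trans_lt h1
  refine ⟨α, h3, ?_, ?_⟩
  · have := hQ α
    have h5 : (p - 1) * ((α - δp) * (α - δm)) < 0 :=
      mul_neg_of_pos_of_neg hp1 (mul_neg_of_neg_of_pos (by linarith) (by linarith))
    nlinarith
  · rw [lt_div_iff₀ hs]
    rw [sub_lt_iff_lt_add, div_lt_iff₀ (by linarith)] at h4
    linarith

/-- Split at `y = √ε x`: on each side the smaller quantity is replaced by the multiple of the larger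
one. -/
lemma rpow_mul_sq_le {p ε : ℝ} (hp : 2 ≤ p) (hε : 0 < ε) {x y : ℝ} (hx : 0 ≤ x) (hy : 0 ≤ y) :
    x ^ (p - 2) * y ^ 2 ≤ ε * x ^ p + (Real.sqrt ε)⁻¹ ^ (p - 2) * y ^ p := by
  have hpow : ∀ z : ℝ, 0 ≤ z → z ^ (p - 2) * z ^ 2 = z ^ p := fun z hz => by
    rw [← Real.rpow_natCast z 2, ← Real.rpow_add_of_nonneg hz (by linarith) (by norm_num)]
    norm_num
  have hsq := Real.sqrt_pos.2 hε
  rcases le_total y (Real.sqrt ε * x) with h | h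
  · have h1 : y ^ 2 ≤ ε * x ^ 2 := by
      calc y ^ 2 ≤ (Real.sqrt ε * x) ^ 2 := by gcongr
        _ = ε * x ^ 2 := by rw [mul_pow, Real.sq_sqrt hε.le]
    calc x ^ (p - 2) * y ^ 2 ≤ x ^ (p - 2) * (ε * x ^ 2) := by gcongr
      _ = ε * x ^ p := by rw [← hpow x hx]; ring
      _ ≤ _ := le_add_of_nonneg_right (by positivity)
  · have h1 : x ≤ (Real.sqrt ε)⁻¹ * y := by
      rw [inv_mul_eq_div, le_div_iff₀ hsq]; linarith
    calc x ^ (p - 2) * y ^ 2 ≤ ((Real.sqrt ε)⁻¹ * y) ^ (p - 2) * y ^ 2 := by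
          gcongr
      _ = (Real.sqrt ε)⁻¹ ^ (p - 2) * y ^ p := by
          rw [Real.mul_rpow (by positivity) hy, mul_assoc, hpow y hy]
      _ ≤ _ := le_add_of_nonneg_left (by positivity)

/-- Young's inequality for the stability term. -/
lemma exists_rpow_mul_add_sq_le {p ε β j : ℝ} (hp : 2 ≤ p) (hε : 0 < ε) :
    ∃ C, 0 ≤ C ∧ ∀ x y : ℝ, 0 ≤ x → 0 ≤ y →
      x ^ (p - 2) * (β * x + j * y) ^ 2 ≤ (β ^ 2 + ε) * x ^ p + C * y ^ p := by
  -- `κ` pays for the cross term of the square and `ε'` for the mixed term `x^(p-2) y^2`; each costs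
  -- at most `ε/2`.
  set κ : ℝ := ε / (2 * (β ^ 2 + 1)) with hκ
  have hκ0 : 0 < κ := by positivity
  set D : ℝ := (1 + κ⁻¹) * j ^ 2 with hD
  have hD0 : 0 ≤ D := by positivity
  set ε' : ℝ := ε / (2 * (D + 1)) with hε'
  have hε0 : 0 < ε' := by positivity
  refine ⟨D * (Real.sqrt ε')⁻¹ ^ (p - 2), by positivity, fun x y hx hy => ?_⟩
  have hpow : x ^ (p - 2) * x ^ 2 = x ^ p := by
    rw [← Real.rpow_natCast x 2, ← Real.rpow_add_of_nonneg hx (by linarith) (by norm_num)]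
    norm_num
  have h1 : (β * x + j * y) ^ 2 ≤ (1 + κ) * β ^ 2 * x ^ 2 + D * y ^ 2 := by
    have h := sq_nonneg (Real.sqrt κ * (β * x) - (Real.sqrt κ)⁻¹ * (j * y))
    have hs := Real.sqrt_pos.2 hκ0
    have e : (Real.sqrt κ * (β * x) - (Real.sqrt κ)⁻¹ * (j * y)) ^ 2 =
        κ * (β * x) ^ 2 - 2 * (β * x) * (j * y) + κ⁻¹ * (j * y) ^ 2 := by
      have h1 : Real.sqrt κ ^ 2 = κ := Real.sq_sqrt hκ0.le
      have h2 : (Real.sqrt κ)⁻¹ ^ 2 = κ⁻¹ := by rw [inv_pow, h1]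
      have h3 : Real.sqrt κ * (Real.sqrt κ)⁻¹ = 1 := mul_inv_cancel₀ hs.ne'
      linear_combination (β * x) ^ 2 * h1 + (j * y) ^ 2 * h2 - 2 * (β * x) * (j * y) * h3
    rw [e] at h
    rw [hD]
    linarith
  have h2 := rpow_mul_sq_le hp hε0 hx hy
  have hxp : 0 ≤ x ^ p := Real.rpow_nonneg hx p
  have h3 : κ * β ^ 2 ≤ ε / 2 := by
    rw [hκ, div_mul_eq_mul_div, div_le_div_iff₀ (by positivity) (by positivity)]
    nlinarith
  have h4 : D * ε' ≤ ε / 2 := by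
    rw [hε', mul_div_assoc', div_le_div_iff₀ (by positivity) (by positivity)]
    nlinarith
  calc x ^ (p - 2) * (β * x + j * y) ^ 2
      ≤ x ^ (p - 2) * ((1 + κ) * β ^ 2 * x ^ 2 + D * y ^ 2) := by gcongr
    _ = (1 + κ) * β ^ 2 * x ^ p + D * (x ^ (p - 2) * y ^ 2) := by rw [← hpow]; ring
    _ ≤ (1 + κ) * β ^ 2 * x ^ p + D * (ε' * x ^ p + (Real.sqrt ε')⁻¹ ^ (p - 2) * y ^ p) := by gcongr
    _ = β ^ 2 * x ^ p + (κ * β ^ 2) * x ^ p + (D * ε') * x ^ p +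
        D * (Real.sqrt ε')⁻¹ ^ (p - 2) * y ^ p := by ring
    _ ≤ β ^ 2 * x ^ p + ε / 2 * x ^ p + ε / 2 * x ^ p +
        D * (Real.sqrt ε')⁻¹ ^ (p - 2) * y ^ p := by gcongr
    _ = _ := by ring

lemma weight_mul_rpow_eq {p α k w e R : ℝ} (hw : 0 < w) (he : 0 < e) (hR : 0 < R) :
    w ^ (-α - 1) * e ^ k * (w / (e * R)) ^ p = w ^ (p - α - 1) * e ^ (k - p) * R ^ (-p) := by
  rw [Real.div_rpow hw.le (by positivity), Real.mul_rpow he.le hR.le, Real.rpow_neg hR.le,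
    Real.rpow_sub he, show p - α - 1 = (-α - 1) + p by ring, Real.rpow_add hw]
  field_simp

/-- The error term in the Caccioppoli estimate is absorbed up to a power of the radius. -/
lemma weight_error_le {p α δ k ε : ℝ} (hs : 0 < δ + p - 1) (hα : p - 1 < α)
    (hk : p * (δ + α) / (δ + p - 1) ≤ k) (hε : 0 < ε) {w e R : ℝ} (hw : 1 ≤ w) (he : 0 < e)
    (he1 : e ≤ 1) (hR : 0 < R) :
    w ^ (-α - 1) * e ^ k * (w / (e * R)) ^ p ≤ ε * (w ^ (-δ - α) * e ^ k) +
      ε ^ (-((α + 1 - p) / (δ + p - 1))) * R ^ (-(p * (δ + α) / (δ + p - 1))) := by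
  have hw0 : 0 < w := by linarith
  set t := (α + 1 - p) / (δ + p - 1) with ht
  have ht0 : 0 < t := div_pos (by linarith) hs
  have hq : p * (δ + α) / (δ + p - 1) = p + p * t := by rw [ht]; field_simp; ring
  rw [hq] at hk ⊢
  have heR : 0 < e * R := by positivity
  -- Either the quotient of the two weights is at most `ε` and the term is absorbed, or `w` is
  -- bounded below by a power of `eR`. In the second case the negative power of `w` yields exactly
  -- `R^{-(p+pt)}`, and the remaining power of `e` is nonnegative by `hk`.
  rcases le_total (w ^ (δ + p - 1)) (ε * (e * R) ^ p) with h | h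
  · refine le_trans ?_ (le_add_of_nonneg_right (by positivity))
    have h1 : w ^ (-α - 1) * e ^ k * (w / (e * R)) ^ p =
        w ^ (-δ - α) * e ^ k * (w ^ (δ + p - 1) / (e * R) ^ p) := by
      rw [Real.div_rpow hw0.le heR.le]
      have : w ^ (-α - 1) * w ^ p = w ^ (-δ - α) * w ^ (δ + p - 1) := by
        rw [← Real.rpow_add hw0, ← Real.rpow_add hw0]; congr 1; ring
      calc _ = (w ^ (-α - 1) * w ^ p) * (e ^ k / (e * R) ^ p) := by ring
        _ = _ := by rw [this]; ring
    rw [h1]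
    have h2 : w ^ (δ + p - 1) / (e * R) ^ p ≤ ε := by
      rwa [div_le_iff₀ (Real.rpow_pos_of_pos heR p)]
    calc _ ≤ w ^ (-δ - α) * e ^ k * ε := by gcongr
      _ = _ := by ring
  · refine le_trans ?_ (le_add_of_nonneg_left (by positivity))
    have hpos : 0 < ε * (e * R) ^ p := by positivity
    have h1 : w ^ (p - α - 1) ≤ (ε * (e * R) ^ p) ^ (-t) := by
      have : w ^ (p - α - 1) = (w ^ (δ + p - 1)) ^ (-t) := by
        rw [← Real.rpow_mul hw0.le, ht]; congr 1; field_simp; ring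
      rw [this]
      exact Real.rpow_le_rpow_of_nonpos hpos h (by linarith)
    rw [weight_mul_rpow_eq hw0 he hR]
    calc w ^ (p - α - 1) * e ^ (k - p) * R ^ (-p)
        ≤ (ε * (e * R) ^ p) ^ (-t) * e ^ (k - p) * R ^ (-p) := by gcongr
      _ = ε ^ (-t) * e ^ (k - (p + p * t)) * R ^ (-(p + p * t)) := by
          rw [Real.mul_rpow hε.le (by positivity), ← Real.rpow_mul heR.le, Real.mul_rpow he.le hR.le,
            show k - (p + p * t) = p * -t + (k - p) by ring, Real.rpow_add he,
            show -(p + p * t) = p * -t + -p by ring, Real.rpow_add hR]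
          ring
      _ ≤ ε ^ (-t) * 1 * R ^ (-(p + p * t)) := by
          gcongr
          exact Real.rpow_le_one he.le he1 (by linarith)
      _ = _ := by ring

lemma weight_mul_rpow_le {p α k : ℝ} (hα : p - 1 < α) (hk : p ≤ k) {w e R : ℝ} (hw : 1 ≤ w)
    (he : 0 < e) (he1 : e ≤ 1) (hR : 0 < R) :
    w ^ (-α - 1) * e ^ k * (w / (e * R)) ^ p ≤ R ^ (-p) := by
  rw [weight_mul_rpow_eq (by linarith) he hR]
  have h1 : w ^ (p - α - 1) ≤ 1 := Real.rpow_le_one_of_one_le_of_nonpos hw (by linarith)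
  have h2 : e ^ (k - p) ≤ 1 := Real.rpow_le_one he.le he1 (by linarith)
  calc _ ≤ 1 * 1 * R ^ (-p) := by gcongr
    _ = _ := by ring

/-- The function `(y, e) ↦ a₀ y + c₀ (y + 1)^{-α} e^k` generating the test functions. -/
def testFun (a₀ c₀ α : ℝ) (k : ℕ) (z : ℝ × ℝ) : ℝ := a₀ * z.1 + c₀ * ((z.1 + 1) ^ (-α) * z.2 ^ k)

/-- The partial derivative of `testFun` in the first variable. -/
def testFunFst (a₀ c₀ α : ℝ) (k : ℕ) (z : ℝ × ℝ) : ℝ :=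
  a₀ - c₀ * (α * ((z.1 + 1) ^ (-α - 1) * z.2 ^ k))

/-- The partial derivative of `testFun` in the second variable. -/
def testFunSnd (c₀ α : ℝ) (k : ℕ) (z : ℝ × ℝ) : ℝ := c₀ * ((z.1 + 1) ^ (-α) * (k * z.2 ^ (k - 1)))

section testFun

variable {a₀ c₀ α : ℝ} {k : ℕ}

lemma hasFDerivAt_testFun {z : ℝ × ℝ} (hz : 0 < z.1) :
    HasFDerivAt (testFun a₀ c₀ α k) (testFunFst a₀ c₀ α k z • ContinuousLinearMap.fst ℝ ℝ ℝ +
      testFunSnd c₀ α k z • ContinuousLinearMap.snd ℝ ℝ ℝ) z := by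
  have h1 : HasFDerivAt (fun z : ℝ × ℝ => z.1) (ContinuousLinearMap.fst ℝ ℝ ℝ) z := hasFDerivAt_fst
  have h2 : HasFDerivAt (fun z : ℝ × ℝ => z.2) (ContinuousLinearMap.snd ℝ ℝ ℝ) z := hasFDerivAt_snd
  have h3 := (h1.add_const 1).rpow_const (p := -α) (Or.inl (by linarith))
  have h4 := h2.pow k
  refine ((h1.const_mul a₀).add ((h3.mul h4).const_mul c₀)).congr_fderiv ?_
  ext
  · simp [testFunFst, testFunSnd]
    ring
  · simp [testFunFst, testFunSnd]

lemma abs_testFunFst_le (hα : 0 ≤ α) (hc : 0 ≤ c₀) {z : ℝ × ℝ}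
    (hz : z ∈ Ioi (0 : ℝ) ×ˢ Icc (0 : ℝ) 1) : |testFunFst a₀ c₀ α k z| ≤ |a₀| + c₀ * α := by
  obtain ⟨h1, h2, h3⟩ := hz
  have h1' : (0 : ℝ) < z.1 := h1
  have hw : (z.1 + 1) ^ (-α - 1) ≤ 1 :=
    Real.rpow_le_one_of_one_le_of_nonpos (by linarith) (by linarith)
  have he : z.2 ^ k ≤ 1 := pow_le_one₀ h2 h3
  refine (abs_sub _ _).trans (add_le_add_right ?_ _)
  rw [abs_of_nonneg (by positivity)]
  have : (z.1 + 1) ^ (-α - 1) * z.2 ^ k ≤ 1 := mul_le_one₀ hw (by positivity) he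
  calc c₀ * (α * ((z.1 + 1) ^ (-α - 1) * z.2 ^ k)) ≤ c₀ * (α * 1) := by gcongr
    _ = _ := by ring

lemma abs_testFunSnd_le (hα : 0 ≤ α) (hc : 0 ≤ c₀) {z : ℝ × ℝ}
    (hz : z ∈ Ioi (0 : ℝ) ×ˢ Icc (0 : ℝ) 1) : |testFunSnd c₀ α k z| ≤ c₀ * k := by
  obtain ⟨h1, h2, h3⟩ := hz
  have h1' : (0 : ℝ) < z.1 := h1
  have hw : (z.1 + 1) ^ (-α) ≤ 1 :=
    Real.rpow_le_one_of_one_le_of_nonpos (by linarith) (by linarith)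
  have he : z.2 ^ (k - 1) ≤ 1 := pow_le_one₀ h2 h3
  rw [testFunSnd, abs_of_nonneg (by positivity)]
  calc c₀ * ((z.1 + 1) ^ (-α) * (k * z.2 ^ (k - 1))) ≤ c₀ * (1 * (k * 1)) := by gcongr
    _ = _ := by ring

/-- Because of the shift `z.1 + 1`, both partial derivatives are bounded on the convex set. -/
lemma lipschitzOnWith_testFun (hα : 0 ≤ α) (hc : 0 ≤ c₀) :
    LipschitzOnWith (|a₀| + c₀ * α + c₀ * k).toNNReal (testFun a₀ c₀ α k)
      (Ioi 0 ×ˢ Icc 0 1) := by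
  refine Convex.lipschitzOnWith_of_nnnorm_hasFDerivWithin_le
    (fun z hz => (hasFDerivAt_testFun hz.1).hasFDerivWithinAt) (fun z hz => ?_)
    ((convex_Ioi 0).prod (convex_Icc 0 1))
  rw [← norm_toNNReal]
  refine Real.toNNReal_le_toNNReal ((norm_add_le _ _).trans (add_le_add ?_ ?_))
  · rw [norm_smul, Real.norm_eq_abs]
    exact (mul_le_of_le_one_right (abs_nonneg _) (ContinuousLinearMap.norm_fst_le _ _ _)).trans
      (abs_testFunFst_le hα hc hz)
  · rw [norm_smul, Real.norm_eq_abs]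
    exact (mul_le_of_le_one_right (abs_nonneg _) (ContinuousLinearMap.norm_snd_le _ _ _)).trans
      (abs_testFunSnd_le hα hc hz)

lemma measurable_testFun : Measurable (testFun a₀ c₀ α k) := by
  unfold testFun; fun_prop

lemma measurable_testFunFst : Measurable (testFunFst a₀ c₀ α k) := by
  unfold testFunFst; fun_prop

lemma measurable_testFunSnd : Measurable (testFunSnd c₀ α k) := by
  unfold testFunSnd; fun_prop

end testFun

variable {X : Type*} [MetricSpace X]

/-- The cutoff function which is `1` on `B(x₀, R)` and `0` off `B(x₀, 2R)`. -/
def cutoff (x₀ : X) (R : ℝ) (x : X) : ℝ := max 0 (min 1 (2 - dist x x₀ / R))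

lemma cutoff_mem (x₀ : X) (R : ℝ) (x : X) : cutoff x₀ R x ∈ Icc (0 : ℝ) 1 :=
  ⟨le_max_left _ _, max_le zero_le_one (min_le_left _ _)⟩

lemma cutoff_eq_one {x₀ : X} {R : ℝ} (hR : 0 < R) {x : X} (hx : x ∈ Metric.ball x₀ R) :
    cutoff x₀ R x = 1 := by
  have : dist x x₀ / R < 1 := (div_lt_one hR).2 hx
  rw [cutoff, min_eq_left (by linarith), max_eq_right zero_le_one]

lemma cutoff_eq_zero {x₀ : X} {R : ℝ} (hR : 0 < R) {x : X} (hx : x ∉ Metric.closedBall x₀ (2 * R)) :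
    cutoff x₀ R x = 0 := by
  have : 2 < dist x x₀ / R := (lt_div_iff₀ hR).2 (not_le.1 hx)
  exact max_eq_left ((min_le_right _ _).trans (by linarith))

lemma lipschitzWith_cutoff (x₀ : X) {R : ℝ} (hR : 0 < R) :
    LipschitzWith R⁻¹.toNNReal (cutoff x₀ R) := by
  refine LipschitzWith.const_max (LipschitzWith.const_min ?_ 1) 0
  refine LipschitzWith.of_dist_le_mul fun x y => ?_
  rw [Real.coe_toNNReal _ (inv_nonneg.2 hR.le), Real.dist_eq,
    show 2 - dist x x₀ / R - (2 - dist y x₀ / R) = R⁻¹ * (dist y x₀ - dist x x₀) by ring, abs_mul,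
    abs_of_pos (inv_pos.2 hR), dist_comm x y]
  gcongr
  exact abs_dist_sub_le y x x₀

end MetricNewtonian
end

/-! ### Test functions in the Newtonian space. -/

noncomputable section

namespace MetricNewtonian

variable {X : Type*} [MetricSpace X] [MeasurableSpace X] [BorelSpace X] [ProperSpace X]
  {p : ℝ} {μ : Measure X} [IsLocallyFiniteMeasure μ]

/-- The pair of the finite value of `u` and of the cutoff function, at which `testFun` is taken. -/
def testPoint (u : X → EReal) (x₀ : X) (R : ℝ) (x : X) : ℝ × ℝ := ((u x).toReal, cutoff x₀ R x)

section

variable {u : X → EReal} {x₀ : X} {R : ℝ}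

lemma testPoint_mem (hu : ∀ x, 0 < u x) {x : X} (hx : u x ≠ ⊤) :
    testPoint u x₀ R x ∈ Ioi (0 : ℝ) ×ˢ Icc (0 : ℝ) 1 :=
  ⟨EReal.toReal_pos (hu x) hx, cutoff_mem x₀ R x⟩

lemma aemeasurable_testPoint (hum : AEMeasurable u μ) (hR : 0 < R) :
    AEMeasurable (testPoint u x₀ R) μ :=
  (measurable_ereal_toReal.comp_aemeasurable hum).prodMk
    (lipschitzWith_cutoff x₀ hR).continuous.measurable.aemeasurable

lemma exists_weakUpperGradient_testFun (hp : 1 ≤ p) {g : X → ENNReal}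
    (hg : IsWeakUpperGradient p μ g u) (hl : LocallyPIntegrable p μ g) (hu : ∀ x, 0 < u x)
    (hum : AEMeasurable u μ) (hfin : ∀ᵐ x ∂μ, u x ≠ ⊤) (hR : 0 < R) {a₀ c₀ α : ℝ} {k : ℕ}
    (hα : 0 ≤ α) (hc : 0 ≤ c₀) {v : X → EReal}
    (hv : ∀ x, u x ≠ ⊤ → v x = (testFun a₀ c₀ α k (testPoint u x₀ R x) : ℝ)) :
    ∃ h : X → ENNReal, IsWeakUpperGradient p μ h v ∧ LocallyPIntegrable p μ h ∧
      ∀ᵐ x ∂μ, h x = ENNReal.ofReal |testFunFst a₀ c₀ α k (testPoint u x₀ R x)| * g x +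
        ENNReal.ofReal |testFunSnd c₀ α k (testPoint u x₀ R x)| * ENNReal.ofReal R⁻¹ := by
  have hp0 : 0 < p := by linarith
  -- `u` is only a.e. measurable while weak upper gradients must be Borel, so the gradient is built
  -- from a Borel representative.
  obtain ⟨z, hzm, hz⟩ := aemeasurable_testPoint (x₀ := x₀) hum hR
  set h : X → ENNReal := fun x => ENNReal.ofReal |testFunFst a₀ c₀ α k (z x)| * g x +
    ENNReal.ofReal |testFunSnd c₀ α k (z x)| * ENNReal.ofReal R⁻¹ with hh
  have hm : Measurable h := by
    refine Measurable.add (Measurable.mul ?_ hg.1) (Measurable.mul_const ?_ _)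
    · exact ENNReal.measurable_ofReal.comp (measurable_testFunFst.comp hzm).norm
    · exact ENNReal.measurable_ofReal.comp (measurable_testFunSnd.comp hzm).norm
  have heq : ∀ᵐ x ∂μ, h x = ENNReal.ofReal |testFunFst a₀ c₀ α k (testPoint u x₀ R x)| * g x +
      ENNReal.ofReal |testFunSnd c₀ α k (testPoint u x₀ R x)| * ENNReal.ofReal R⁻¹ := by
    filter_upwards [hz] with x hx
    rw [hx]
  refine ⟨h, ?_, fun x => ?_, heq⟩
  · exact hg.chain hp0 hl hu (lipschitzWith_cutoff x₀ hR) (cutoff_mem x₀ R)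
      (lipschitzOnWith_testFun hα hc) (fun z hz => hasFDerivAt_testFun hz.1) hv hm
      (heq.mono fun x hx => hx.ge)
  · obtain ⟨U, hU, hxU, hUfin⟩ := hl x
    obtain ⟨W, hxW, hWo, hWfin⟩ := μ.exists_isOpen_measure_lt_top x
    refine ⟨U ∩ W, hU.inter hWo, ⟨hxU, hxW⟩, ?_⟩
    set MA := ENNReal.ofReal (|a₀| + c₀ * α)
    set MB := ENNReal.ofReal (c₀ * k) * ENNReal.ofReal R⁻¹
    have hle : ∀ᵐ y ∂μ.restrict (U ∩ W), h y ^ p ≤ (MA * g y + MB) ^ p := by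
      filter_upwards [ae_restrict_of_ae heq, ae_restrict_of_ae hfin] with y hy hyt
      rw [hy]
      have hmem := testPoint_mem (x₀ := x₀) (R := R) hu hyt
      gcongr
      · exact ENNReal.ofReal_le_ofReal (abs_testFunFst_le hα hc hmem)
      · exact mul_le_mul_left (ENNReal.ofReal_le_ofReal (abs_testFunSnd_le hα hc hmem)) _
    refine (lintegral_mono_ae hle).trans_lt ?_
    refine ENNReal.lintegral_rpow_add_lt_top_of_lintegral_rpow_lt_top
      (hg.1.const_mul _).aemeasurable ?_ ?_ hp
    · simp_rw [ENNReal.mul_rpow_of_nonneg _ _ hp0.le]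
      rw [lintegral_const_mul _ (hg.1.pow_const p)]
      exact ENNReal.mul_lt_top (ENNReal.rpow_lt_top_of_nonneg hp0.le ENNReal.ofReal_ne_top)
        ((lintegral_mono_set inter_subset_left).trans_lt hUfin)
    · rw [setLIntegral_const]
      exact ENNReal.mul_lt_top (ENNReal.rpow_lt_top_of_nonneg hp0.le
        (ENNReal.mul_ne_top ENNReal.ofReal_ne_top ENNReal.ofReal_ne_top))
        ((measure_mono inter_subset_right).trans_lt hWfin)

lemma tsupport_testFun_subset {c₀ α : ℝ} {k : ℕ} (hk : k ≠ 0) (hR : 0 < R) :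
    tsupport (fun x => testFun 0 c₀ α k (testPoint u x₀ R x)) ⊆ Metric.closedBall x₀ (2 * R) := by
  refine closure_minimal (fun x hx => ?_) Metric.isClosed_closedBall
  by_contra hcon
  exact hx (by simp [testFun, testPoint, cutoff_eq_zero hR hcon, hk])

lemma hasCompactSupport_testFun {c₀ α : ℝ} {k : ℕ} (hk : k ≠ 0) (hR : 0 < R) :
    HasCompactSupport (fun x => testFun 0 c₀ α k (testPoint u x₀ R x)) :=
  (isCompact_closedBall x₀ (2 * R)).of_isClosed_subset (isClosed_tsupport _)
    (tsupport_testFun_subset hk hR)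

/-- The requirement `2 ≤ k` makes the `η`-derivative, which contains `η^(k-1)`, vanish off the ball.
The gradient is therefore globally, not just locally, `p`-integrable. -/
lemma memNewtonian_testFun (hp : 1 ≤ p) {g : X → ENNReal}
    (hg : IsWeakUpperGradient p μ g u) (hl : LocallyPIntegrable p μ g) (hu : ∀ x, 0 < u x)
    (hum : AEMeasurable u μ) (hfin : ∀ᵐ x ∂μ, u x ≠ ⊤) (hR : 0 < R) {c₀ α : ℝ} {k : ℕ}
    (hα : 0 ≤ α) (hc : 0 ≤ c₀) (hk : 2 ≤ k) :
    MemNewtonian p μ (fun x => (testFun 0 c₀ α k (testPoint u x₀ R x) : EReal)) := by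
  have hp0 : 0 < p := by linarith
  have hK := isCompact_closedBall x₀ (2 * R)
  have hzero : ∀ {f : X → ENNReal}, (∀ᵐ x ∂μ, x ∉ Metric.closedBall x₀ (2 * R) → f x = 0) →
      ∫⁻ x, f x ∂μ = ∫⁻ x in Metric.closedBall x₀ (2 * R), f x ∂μ := fun {f} hf => by
    rw [← lintegral_indicator measurableSet_closedBall]
    refine lintegral_congr_ae ?_
    filter_upwards [hf] with x hx
    by_cases hmem : x ∈ Metric.closedBall x₀ (2 * R)
    · rw [indicator_of_mem hmem]
    · rw [indicator_of_notMem hmem, hx hmem]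
  obtain ⟨h, hw, hhl, heq⟩ := exists_weakUpperGradient_testFun (x₀ := x₀) hp hg hl hu hum hfin hR
    (a₀ := 0) (k := k) hα hc
    (v := fun x => (testFun 0 c₀ α k (testPoint u x₀ R x) : EReal)) fun x _ => rfl
  rw [MemNewtonian, MemNewtonianOn, Measure.restrict_univ]
  refine ⟨?_, ?_, hw.exists_isUpperGradient hp ?_⟩
  · exact measurable_coe_real_ereal.comp_aemeasurable
      (measurable_testFun.comp_aemeasurable (aemeasurable_testPoint hum hR))
  · rw [hzero (Filter.Eventually.of_forall fun x hx => by
      simp [testFun, testPoint, cutoff_eq_zero hR hx, show k ≠ 0 by omega, hp0])]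
    refine lt_of_le_of_lt (lintegral_mono_ae (g := fun _ => ENNReal.ofReal c₀ ^ p) ?_) ?_
    · filter_upwards [ae_restrict_of_ae hfin] with x hx
      obtain ⟨h1, h2, h3⟩ := testPoint_mem (x₀ := x₀) (R := R) hu hx
      have h1' : 0 < (testPoint u x₀ R x).1 := h1
      rw [EReal.abs_def]
      gcongr
      rw [testFun, zero_mul, zero_add, abs_of_nonneg (by positivity)]
      refine mul_le_of_le_one_right hc (mul_le_one₀ ?_ (by positivity) (pow_le_one₀ h2 h3))
      exact Real.rpow_le_one_of_one_le_of_nonpos (by linarith) (by linarith)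
    · rw [setLIntegral_const]
      exact ENNReal.mul_lt_top (ENNReal.rpow_lt_top_of_nonneg hp0.le ENNReal.ofReal_ne_top)
        hK.measure_lt_top
  · rw [hzero]
    · exact hhl.lintegral_lt_top hK
    · filter_upwards [heq] with x hx hmem
      rw [hx]
      simp [testFunFst, testFunSnd, testPoint, cutoff_eq_zero hR hmem, show k ≠ 0 by omega,
        show k - 1 ≠ 0 by omega, hp0]

end

end MetricNewtonian
end

/-! ### Weights and the Caccioppoli inequality. -/

noncomputable section

namespace MetricNewtonian

variable {X : Type*} [MetricSpace X] [MeasurableSpace X] [BorelSpace X] [ProperSpace X]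
  {p : ℝ} {μ : Measure X} [IsLocallyFiniteMeasure μ]

lemma LocallyPIntegrable.ae_ne_top [Nonempty X] (hp : 0 < p) {g : X → ENNReal}
    (hl : LocallyPIntegrable p μ g) (hm : Measurable g) : ∀ᵐ x ∂μ, g x ≠ ⊤ := by
  obtain ⟨x₀⟩ := ‹Nonempty X›
  rw [← Measure.restrict_univ (μ := μ), ← Metric.iUnion_closedBall_nat x₀, ae_restrict_iUnion_iff]
  intro n
  filter_upwards [ae_lt_top (hm.pow_const p) (hl.lintegral_lt_top (isCompact_closedBall x₀ n)).ne]
    with x hx hxt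
  simp [hxt, hp] at hx

lemma LocallyIntegrable.integrable_of_eq_zero {f : X → ℝ} (hf : LocallyIntegrable f μ) {K : Set X}
    (hK : IsCompact K) (h : ∀ x, x ∉ K → f x = 0) : Integrable f μ :=
  (hf.integrableOn_isCompact hK).integrable_of_forall_notMem_eq_zero h

lemma le_sub_of_ereal_le {P Q c : ℝ} (hQ : 0 ≤ Q) {A B : ENNReal} (hA : ENNReal.ofReal P ≤ A)
    (hB : B ≤ ENNReal.ofReal Q) (h : (A : EReal) ≤ (B : EReal) - (c : EReal)) : P ≤ Q - c := by
  have h1 : ((ENNReal.ofReal P : ENNReal) : EReal) ≤ ((ENNReal.ofReal Q : ENNReal) : EReal) - c :=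
    (EReal.coe_ennreal_le_coe_ennreal_iff.2 hA).trans
      (h.trans (EReal.sub_le_sub (EReal.coe_ennreal_le_coe_ennreal_iff.2 hB) le_rfl))
  rw [EReal.coe_ennreal_ofReal, EReal.coe_ennreal_ofReal, max_eq_left hQ, ← EReal.coe_sub,
    EReal.coe_le_coe_iff] at h1
  exact (le_max_left _ _).trans h1

lemma le_of_ereal_le {Q c : ℝ} (hQ : 0 ≤ Q) {B : ENNReal} (hB : B ≤ ENNReal.ofReal Q)
    (h : (c : EReal) ≤ (B : EReal)) : c ≤ Q := by
  have h1 := h.trans (EReal.coe_ennreal_le_coe_ennreal_iff.2 hB)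
  rwa [EReal.coe_ennreal_ofReal, max_eq_left hQ, EReal.coe_le_coe_iff] at h1

/-- The weight `(u + 1)^{-α-1} η^k`. -/
def weight (u : X → EReal) (x₀ : X) (R α : ℝ) (k : ℕ) (x : X) : ℝ :=
  ((u x).toReal + 1) ^ (-α - 1) * cutoff x₀ R x ^ k

/-- The quotient `(u + 1) / (η R)`. -/
def ratio (u : X → EReal) (x₀ : X) (R : ℝ) (x : X) : ℝ :=
  ((u x).toReal + 1) / (cutoff x₀ R x * R)

/-- The density `u^{-δ} (u + 1)^{-α} η^k`. -/
def mainDensity (u : X → EReal) (x₀ : X) (R δ α : ℝ) (k : ℕ) (x : X) : ℝ :=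
  (u x).toReal ^ (-δ) * (((u x).toReal + 1) ^ (-α) * cutoff x₀ R x ^ k)

section

variable {u : X → EReal} {x₀ : X} {R δ α : ℝ} {k : ℕ}

lemma weight_nonneg (hu : ∀ x, 0 < u x) (x : X) : 0 ≤ weight u x₀ R α k x := by
  have h1 : 0 ≤ (u x).toReal := EReal.toReal_nonneg (hu x).le
  have h2 := (cutoff_mem x₀ R x).1
  rw [weight]; positivity

lemma weight_le_one (hu : ∀ x, 0 < u x) (hα : 0 ≤ α) (x : X) : weight u x₀ R α k x ≤ 1 := by
  have h1 : 0 ≤ (u x).toReal := EReal.toReal_nonneg (hu x).le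
  have h2 := cutoff_mem x₀ R x
  exact mul_le_one₀ (Real.rpow_le_one_of_one_le_of_nonpos (by linarith) (by linarith))
    (pow_nonneg h2.1 k) (pow_le_one₀ h2.1 h2.2)

lemma ratio_nonneg (hu : ∀ x, 0 < u x) (hR : 0 < R) (x : X) : 0 ≤ ratio u x₀ R x := by
  have h1 : 0 ≤ (u x).toReal := EReal.toReal_nonneg (hu x).le
  have h2 := (cutoff_mem x₀ R x).1
  rw [ratio]; positivity

lemma weight_eq_zero (hk : k ≠ 0) (hR : 0 < R) {x : X} (hx : x ∉ Metric.closedBall x₀ (2 * R)) :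
    weight u x₀ R α k x = 0 := by
  simp [weight, cutoff_eq_zero hR hx, hk]

lemma mainDensity_eq_zero (hk : k ≠ 0) (hR : 0 < R) {x : X}
    (hx : x ∉ Metric.closedBall x₀ (2 * R)) : mainDensity u x₀ R δ α k x = 0 := by
  simp [mainDensity, cutoff_eq_zero hR hx, hk]

/-- Up to the factor `k` this is the contribution of the cutoff to the gradient of `(u+1)^{-α} η^k`.
Writing it as weight times ratio exhibits the gradient of `u + φ` as a convex combination. Where `η
= 0`, division by zero is harmless since both sides vanish. -/
lemma weight_mul_ratio (hu : ∀ x, 0 < u x) (hR : 0 < R) (hk : 2 ≤ k) (x : X) :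
    weight u x₀ R α k x * ratio u x₀ R x =
      ((u x).toReal + 1) ^ (-α) * cutoff x₀ R x ^ (k - 1) * R⁻¹ := by
  have h1 : 0 ≤ (u x).toReal := EReal.toReal_nonneg (hu x).le
  have hw : 0 < (u x).toReal + 1 := by linarith
  rcases (cutoff_mem x₀ R x).1.eq_or_lt with h0 | h0
  · simp [weight, ← h0, show k ≠ 0 by omega, show k - 1 ≠ 0 by omega]
  · obtain ⟨j, rfl⟩ : ∃ j, k = j + 1 := ⟨k - 1, by omega⟩
    rw [weight, ratio, show -α = (-α - 1) + 1 by ring, Real.rpow_add hw, Real.rpow_one]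
    simp only [add_sub_cancel_right, Nat.add_sub_cancel, pow_succ]
    field_simp

lemma aemeasurable_weight (hum : AEMeasurable u μ) (hR : 0 < R) :
    AEMeasurable (weight u x₀ R α k) μ := by
  have : Measurable fun z : ℝ × ℝ => (z.1 + 1) ^ (-α - 1) * z.2 ^ k := by fun_prop
  exact this.comp_aemeasurable (aemeasurable_testPoint (x₀ := x₀) hum hR)

lemma aemeasurable_ratio (hum : AEMeasurable u μ) (hR : 0 < R) :
    AEMeasurable (ratio u x₀ R) μ := by
  have : Measurable fun z : ℝ × ℝ => (z.1 + 1) / (z.2 * R) := by fun_prop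
  exact this.comp_aemeasurable (aemeasurable_testPoint (x₀ := x₀) hum hR)

lemma weight_mul_ratio_rpow_le (hu : ∀ x, 0 < u x) (hα : p - 1 < α) (hk : p ≤ k) (hk0 : k ≠ 0)
    (hR : 0 < R) (x : X) : weight u x₀ R α k x * ratio u x₀ R x ^ p ≤ R ^ (-p) := by
  have h1 : 0 ≤ (u x).toReal := EReal.toReal_nonneg (hu x).le
  obtain ⟨h2, h3⟩ := cutoff_mem x₀ R x
  rcases h2.eq_or_lt with h0 | h0
  · simp only [weight, ← h0, zero_pow hk0, mul_zero, zero_mul]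
    positivity
  · have := weight_mul_rpow_le hα hk (by linarith : 1 ≤ (u x).toReal + 1) h0 h3 hR
    rwa [Real.rpow_natCast] at this

lemma integrable_weight_mul_ratio_rpow (hu : ∀ x, 0 < u x) (hum : AEMeasurable u μ)
    (hα : p - 1 < α) (hk : p ≤ k) (hk0 : k ≠ 0) (hR : 0 < R) :
    Integrable (fun x => weight u x₀ R α k x * ratio u x₀ R x ^ p) μ := by
  refine IntegrableOn.integrable_of_forall_notMem_eq_zero (s := Metric.closedBall x₀ (2 * R)) ?_
    fun x hx => by simp only [weight_eq_zero hk0 hR hx, zero_mul]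
  refine Measure.integrableOn_of_bounded (M := R ^ (-p))
    (isCompact_closedBall x₀ (2 * R)).measure_lt_top.ne
    ((aemeasurable_weight hum hR).mul ((aemeasurable_ratio hum hR).pow_const p)).aestronglyMeasurable
    (Filter.Eventually.of_forall fun x => ?_)
  rw [Real.norm_of_nonneg (mul_nonneg (weight_nonneg hu x) (Real.rpow_nonneg (ratio_nonneg hu hR x) p))]
  exact weight_mul_ratio_rpow_le hu hα hk hk0 hR x

lemma LocallyPIntegrable.integrableOn_toReal_rpow {g : X → ENNReal}
    (hl : LocallyPIntegrable p μ g) (hm : Measurable g) {K : Set X} (hK : IsCompact K) :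
    IntegrableOn (fun x => (g x).toReal ^ p) K μ := by
  have := integrable_toReal_of_lintegral_ne_top (hm.pow_const p).aemeasurable
    (hl.lintegral_lt_top hK).ne
  simpa only [ENNReal.toReal_rpow, IntegrableOn] using this

lemma integrable_weight_mul_rpow (hu : ∀ x, 0 < u x) (hum : AEMeasurable u μ) {g : X → ENNReal}
    (hl : LocallyPIntegrable p μ g) (hm : Measurable g) (hα : 0 ≤ α) (hk0 : k ≠ 0) (hR : 0 < R) :
    Integrable (fun x => weight u x₀ R α k x * (g x).toReal ^ p) μ := by
  refine IntegrableOn.integrable_of_forall_notMem_eq_zero (s := Metric.closedBall x₀ (2 * R)) ?_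
    fun x hx => by simp only [weight_eq_zero hk0 hR hx, zero_mul]
  refine Integrable.mono' (hl.integrableOn_toReal_rpow hm (isCompact_closedBall x₀ (2 * R)))
    (((aemeasurable_weight hum hR).restrict).mul
      (hm.ennreal_toReal.pow_const p).aemeasurable).aestronglyMeasurable
    (Filter.Eventually.of_forall fun x => ?_)
  have hgp : 0 ≤ (g x).toReal ^ p := Real.rpow_nonneg ENNReal.toReal_nonneg p
  rw [Real.norm_of_nonneg (mul_nonneg (weight_nonneg hu x) hgp)]
  exact mul_le_of_le_one_left hgp (weight_le_one hu hα x)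

/-- Used with `a₀ = 0` for the test function `φ` and with `a₀ = 1` for `u + φ`. -/
lemma exists_isMinimal_testFun_le (hp : 1 ≤ p) {g : X → ENNReal}
    (hg : IsWeakUpperGradient p μ g u) (hl : LocallyPIntegrable p μ g) (hu : ∀ x, 0 < u x)
    (hum : AEMeasurable u μ) (hfin : ∀ᵐ x ∂μ, u x ≠ ⊤) (hR : 0 < R) {a₀ c₀ : ℝ}
    (hα : 0 ≤ α) (hc : 0 ≤ c₀) {v : X → EReal}
    (hv : ∀ x, u x ≠ ⊤ → v x = (testFun a₀ c₀ α k (testPoint u x₀ R x) : ℝ)) :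
    ∃ h : X → ENNReal, IsMinimalWeakUpperGradient p μ h v ∧
      ∀ᵐ x ∂μ, h x ≤ ENNReal.ofReal |testFunFst a₀ c₀ α k (testPoint u x₀ R x)| * g x +
        ENNReal.ofReal |testFunSnd c₀ α k (testPoint u x₀ R x)| * ENNReal.ofReal R⁻¹ := by
  obtain ⟨h, hw, hhl, heq⟩ := exists_weakUpperGradient_testFun hp hg hl hu hum hfin hR hα hc hv
  obtain ⟨h₀, hmin⟩ := exists_isMinimalWeakUpperGradient (by linarith) hw hhl
  refine ⟨h₀, hmin, ?_⟩
  filter_upwards [hmin.2.2 h hw hhl, heq] with x h1 h2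
  exact h1.trans h2.le

/-- The Caccioppoli type inequality obtained by comparing `u` with `u + φ`. -/
lemma IsVariationalMinimizer.caccioppoli [Nonempty X] (hp : 2 ≤ p)
    (hmin : IsVariationalMinimizer p μ (fun t : ℝ => -(t ^ (-δ))) u) {g : X → ENNReal}
    (hg : IsMinimalWeakUpperGradient p μ g u) (hum : AEMeasurable u μ) (hfin : ∀ᵐ x ∂μ, u x ≠ ⊤)
    (hα : p - 1 < α) (hk : p ≤ k) (hR : 0 < R) :
    Integrable (mainDensity u x₀ R δ α k) μ ∧
      ∫ x, weight u x₀ R α k x * (g x).toReal ^ p ∂μ ≤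
        (k / α) ^ p * ∫ x, weight u x₀ R α k x * ratio u x₀ R x ^ p ∂μ +
          α⁻¹ * ∫ x, mainDensity u x₀ R δ α k x ∂μ := by
  obtain ⟨-, hu, htest⟩ := hmin
  have hα0 : 0 < α := by linarith
  have hp0 : 0 < p := by linarith
  have hk2 : 2 ≤ k := by exact_mod_cast hp.trans hk
  have hk0 : k ≠ 0 := by omega
  set φ : X → ℝ := fun x => testFun 0 α⁻¹ α k (testPoint u x₀ R x) with hφ
  have hφeq : ∀ x, φ x = α⁻¹ * (((u x).toReal + 1) ^ (-α) * cutoff x₀ R x ^ k) := fun x => by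
    simp [hφ, testFun, testPoint]
  have hcs : HasCompactSupport φ := hasCompactSupport_testFun hk0 hR
  obtain ⟨hI1, -, hineq⟩ := htest φ
    (memNewtonian_testFun (by linarith) hg.1 hg.2.1 hu hum hfin hR hα0.le (inv_nonneg.2 hα0.le) hk2)
    hcs
  have hfφ : ∀ x, -((u x).toReal ^ (-δ)) * φ x = -α⁻¹ * mainDensity u x₀ R δ α k x := fun x => by
    rw [hφeq, mainDensity]; ring
  have hFint : Integrable (mainDensity u x₀ R δ α k) μ := by
    have h1 := LocallyIntegrable.integrable_of_eq_zero hI1 (isCompact_closedBall x₀ (2 * R))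
      fun x hx => by
        have h : mainDensity u x₀ R δ α k x = 0 := mainDensity_eq_zero hk0 hR hx
        change -((u x).toReal ^ (-δ)) * φ x = 0
        rw [hfφ, h, mul_zero]
    have h2 := h1.const_mul (-α)
    refine h2.congr (Filter.Eventually.of_forall fun x => ?_)
    change -α * (-((u x).toReal ^ (-δ)) * φ x) = _
    rw [hfφ]
    field_simp
  refine ⟨hFint, ?_⟩
  obtain ⟨gφ, hgφ, -⟩ := exists_isMinimal_testFun_le (v := fun x => (φ x : EReal)) (x₀ := x₀)
    (by linarith) hg.1 hg.2.1 hu hum hfin hR (a₀ := 0) (k := k) hα0.le (inv_nonneg.2 hα0.le)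
    fun x _ => rfl
  obtain ⟨gv, hgv, hgvle⟩ := exists_isMinimal_testFun_le (v := fun x => u x + (φ x : EReal)) (x₀ := x₀)
    (by linarith) hg.1 hg.2.1 hu hum hfin hR (a₀ := 1) (k := k) hα0.le (inv_nonneg.2 hα0.le)
    fun x hx => by
      have hux : u x = ((u x).toReal : EReal) :=
        (EReal.coe_toReal hx (ne_bot_of_gt (hu x))).symm
      rw [hφeq]
      nth_rw 1 [hux]
      rw [← EReal.coe_add]
      simp [testFun, testPoint]
  have h1 := (hineq g gφ gv hg hgφ hgv).1
  set T := tsupport φ with hT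
  have hTc : IsCompact T := hcs
  have hTm : MeasurableSet T := (isClosed_tsupport φ).measurableSet
  have hgfin : ∀ᵐ x ∂μ, g x ≠ ⊤ := hg.2.1.ae_ne_top hp0 hg.1.1
  -- The factor `(u+1)^{-α}` never vanishes, so the weights live on `T` and their integrals over `T`
  -- are integrals over `X`.
  have hφ0 : ∀ x, x ∉ T → cutoff x₀ R x = 0 := fun x hx => by
    have h0 := image_eq_zero_of_notMem_tsupport hx
    have hupos : 0 ≤ (u x).toReal := EReal.toReal_nonneg (hu x).le
    rw [hφeq] at h0
    have hw : ((u x).toReal + 1) ^ (-α) ≠ 0 := (Real.rpow_pos_of_pos (by linarith) _).ne'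
    simpa [hα0.ne', hw, hk0] using h0
  have hw0 : ∀ x, x ∉ T → weight u x₀ R α k x = 0 := fun x hx => by
    simp [weight, hφ0 x hx, hk0]
  have hGT := hg.2.1.integrableOn_toReal_rpow hg.1.1 hTc
  have hag := integrable_weight_mul_rpow (x₀ := x₀) (k := k) hu hum hg.2.1 hg.1.1 hα0.le hk0 hR
  have hay := integrable_weight_mul_ratio_rpow (x₀ := x₀) hu hum hα hk hk0 hR
  -- The convexity bound for the energy density of `u + φ`. Its first term is integrable on the
  -- compact set `T` and cancels the energy of `u`.
  have hQint : IntegrableOn (fun x => (g x).toReal ^ p - weight u x₀ R α k x * (g x).toReal ^ p +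
      (k / α) ^ p * (weight u x₀ R α k x * ratio u x₀ R x ^ p)) T μ :=
    (hGT.sub hag.integrableOn).add (hay.integrableOn.const_mul _)
  have hQnn : ∀ x, 0 ≤ (g x).toReal ^ p - weight u x₀ R α k x * (g x).toReal ^ p +
      (k / α) ^ p * (weight u x₀ R α k x * ratio u x₀ R x ^ p) := fun x => by
    have hgp : 0 ≤ (g x).toReal ^ p := Real.rpow_nonneg ENNReal.toReal_nonneg p
    have h2 := mul_le_of_le_one_left hgp (weight_le_one (x₀ := x₀) (R := R) (k := k) hu hα0.le x)
    have h3 := Real.rpow_nonneg (ratio_nonneg (x₀ := x₀) hu hR x) p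
    have h4 := weight_nonneg (x₀ := x₀) (R := R) (k := k) (α := α) hu x
    have h5 : 0 ≤ ((k : ℝ) / α) ^ p := by positivity
    have := mul_nonneg h5 (mul_nonneg h4 h3)
    linarith
  have key := le_sub_of_ereal_le (P := ∫ x in T, (g x).toReal ^ p ∂μ)
    (Q := ∫ x in T, ((g x).toReal ^ p - weight u x₀ R α k x * (g x).toReal ^ p +
      (k / α) ^ p * (weight u x₀ R α k x * ratio u x₀ R x ^ p)) ∂μ)
    (integral_nonneg hQnn) ?_ ?_ h1
  · have e1 : ∫ x, -((u x).toReal ^ (-δ)) * φ x ∂μ = -α⁻¹ * ∫ x, mainDensity u x₀ R δ α k x ∂μ := by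
      rw [← integral_const_mul]
      exact integral_congr_ae (Filter.Eventually.of_forall hfφ)
    have e2 := integral_add (hGT.sub hag.integrableOn) (hay.integrableOn.const_mul ((k / α) ^ p))
    have e3 := integral_sub hGT (hag.integrableOn (s := T))
    simp only [Pi.sub_apply] at e2
    have e4 : ∀ f : X → ℝ, ∫ x in T, weight u x₀ R α k x * f x ∂μ =
        ∫ x, weight u x₀ R α k x * f x ∂μ := fun f =>
      setIntegral_eq_integral_of_forall_compl_eq_zero fun x hx => by rw [hw0 x hx, zero_mul]
    rw [e1, e2, e3, integral_const_mul, e4, e4] at key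
    linarith
  · rw [ofReal_integral_eq_lintegral_ofReal hGT (Filter.Eventually.of_forall fun x =>
      Real.rpow_nonneg ENNReal.toReal_nonneg p)]
    refine lintegral_mono fun x => ?_
    rw [← ENNReal.ofReal_rpow_of_nonneg ENNReal.toReal_nonneg hp0.le]
    exact ENNReal.rpow_le_rpow ENNReal.ofReal_toReal_le hp0.le
  · rw [ofReal_integral_eq_lintegral_ofReal hQint (Filter.Eventually.of_forall hQnn)]
    refine lintegral_mono_ae (ae_restrict_of_ae ?_)
    filter_upwards [hgvle, hgfin] with x hx hgx
    set a := weight u x₀ R α k x with ha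
    have ha0 : 0 ≤ a := weight_nonneg hu x
    have ha1 : a ≤ 1 := weight_le_one hu hα0.le x
    have hy0 : 0 ≤ ratio u x₀ R x := ratio_nonneg hu hR x
    have hupos : 0 ≤ (u x).toReal := EReal.toReal_nonneg (hu x).le
    have hη := cutoff_mem x₀ R x
    -- The normalization `α⁻¹` in `φ` is chosen to make this coefficient exactly `1 - a`.
    have e1 : testFunFst 1 α⁻¹ α k (testPoint u x₀ R x) = 1 - a := by
      simp only [testFunFst, testPoint, ha, weight]
      rw [← mul_assoc, inv_mul_cancel₀ hα0.ne', one_mul]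
    have e2 : testFunSnd α⁻¹ α k (testPoint u x₀ R x) * R⁻¹ = a * (k / α * ratio u x₀ R x) := by
      have := weight_mul_ratio (x₀ := x₀) (α := α) hu hR hk2 x
      calc _ = (k / α) * (((u x).toReal + 1) ^ (-α) * cutoff x₀ R x ^ (k - 1) * R⁻¹) := by
            simp only [testFunSnd, testPoint]; ring
        _ = _ := by rw [← this]; ring
    have e3 : 0 ≤ testFunSnd α⁻¹ α k (testPoint u x₀ R x) := by
      simp only [testFunSnd, testPoint]
      have := hη.1
      positivity
    rw [e1, abs_of_nonneg (by linarith : 0 ≤ 1 - a), abs_of_nonneg e3, ← ENNReal.ofReal_mul e3, e2,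
      ← ENNReal.ofReal_toReal hgx, ← ENNReal.ofReal_mul (by linarith), ← ENNReal.ofReal_add
        (mul_nonneg (by linarith) ENNReal.toReal_nonneg) (by positivity)] at hx
    have hb0 : 0 ≤ (1 - a) * (g x).toReal + a * (k / α * ratio u x₀ R x) :=
      add_nonneg (mul_nonneg (by linarith) ENNReal.toReal_nonneg) (by positivity)
    refine (ENNReal.rpow_le_rpow hx hp0.le).trans ?_
    rw [ENNReal.ofReal_rpow_of_nonneg hb0 hp0.le]
    refine ENNReal.ofReal_le_ofReal ?_
    have hconv := (convexOn_rpow (by linarith : 1 ≤ p)).2 (x := (g x).toReal)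
      (y := k / α * ratio u x₀ R x) ENNReal.toReal_nonneg (mem_Ici.2 (by positivity))
      (by linarith : 0 ≤ 1 - a) ha0 (by ring)
    simp only [smul_eq_mul] at hconv
    refine hconv.trans_eq ?_
    rw [Real.mul_rpow (by positivity) hy0]
    ring

end

end MetricNewtonian
end

/-! ### Stability, the energy estimate and volume growth. -/

noncomputable section

namespace MetricNewtonian

variable {X : Type*} [MetricSpace X] [MeasurableSpace X] [BorelSpace X] [ProperSpace X]
  {p : ℝ} {μ : Measure X} [IsLocallyFiniteMeasure μ] {u : X → EReal} {x₀ : X} {R δ α : ℝ}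

lemma deriv_neg_rpow_neg {t : ℝ} (ht : 0 < t) :
    deriv (fun t : ℝ => -(t ^ (-δ))) t = δ * t ^ (-δ - 1) := by
  have h : HasDerivAt (fun t : ℝ => -(t ^ (-δ))) (-(-δ * t ^ (-δ - 1))) t :=
    (Real.hasDerivAt_rpow_const (p := -δ) (Or.inl ht.ne')).neg
  rw [h.deriv]
  ring

/-- The consequence of the stability inequality. -/
lemma IsVariationalMinimizer.stability [Nonempty X] (hp : 2 ≤ p) (hδ : 0 < δ)
    (hmin : IsVariationalMinimizer p μ (fun t : ℝ => -(t ^ (-δ))) u) {g : X → ENNReal}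
    (hg : IsMinimalWeakUpperGradient p μ g u) (hum : AEMeasurable u μ) (hfin : ∀ᵐ x ∂μ, u x ≠ ⊤)
    (hα : p - 1 < α) {j : ℕ} (hj : 2 ≤ j) (hk : p ≤ (2 * j : ℕ)) (hR : 0 < R) {ε C : ℝ} (hε : 0 ≤ ε)
    (hC0 : 0 ≤ C)
    (hC : ∀ x y : ℝ, 0 ≤ x → 0 ≤ y → x ^ (p - 2) * ((α - 1) / 2 * x + j * y) ^ 2 ≤
      (((α - 1) / 2) ^ 2 + ε) * x ^ p + C * y ^ p)
    (hI : Integrable (mainDensity u x₀ R δ α (2 * j)) μ) :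
    δ * ∫ x, mainDensity u x₀ R δ α (2 * j) x ∂μ ≤ (p - 1) *
      ((((α - 1) / 2) ^ 2 + ε) * ∫ x, weight u x₀ R α (2 * j) x * (g x).toReal ^ p ∂μ +
        C * ∫ x, weight u x₀ R α (2 * j) x * ratio u x₀ R x ^ p ∂μ) := by
  obtain ⟨-, hu, htest⟩ := hmin
  set β := (α - 1) / 2 with hβ
  have hβ0 : 0 ≤ β := by rw [hβ]; linarith
  have hα0 : 0 < α := by linarith
  have hp0 : 0 < p := by linarith
  have hj0 : j ≠ 0 := by omega
  have h2j : 2 * j ≠ 0 := by omega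
  set φ : X → ℝ := fun x => testFun 0 1 β j (testPoint u x₀ R x) with hφ
  have hφeq : ∀ x, φ x = ((u x).toReal + 1) ^ (-β) * cutoff x₀ R x ^ j := fun x => by
    simp [hφ, testFun, testPoint]
  have hcs : HasCompactSupport φ := hasCompactSupport_testFun hj0 hR
  obtain ⟨-, hI2, hineq⟩ := htest φ
    (memNewtonian_testFun (by linarith) hg.1 hg.2.1 hu hum hfin hR hβ0 zero_le_one hj) hcs
  obtain ⟨gφ, hgφ, hgφle⟩ := exists_isMinimal_testFun_le (v := fun x => (φ x : EReal)) (x₀ := x₀)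
    (by linarith) hg.1 hg.2.1 hu hum hfin hR (a₀ := 0) (k := j) hβ0 zero_le_one fun x _ => rfl
  obtain ⟨gv, hgv, -⟩ := exists_isMinimal_testFun_le (v := fun x => u x + (φ x : EReal)) (x₀ := x₀)
    (by linarith) hg.1 hg.2.1 hu hum hfin hR (a₀ := 1) (k := j) hβ0 zero_le_one
    fun x hx => by
      have hux : u x = ((u x).toReal : EReal) :=
        (EReal.coe_toReal hx (ne_bot_of_gt (hu x))).symm
      rw [hφeq]
      nth_rw 1 [hux]
      rw [← EReal.coe_add]
      simp [testFun, testPoint]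
  have h1 := (hineq g gφ gv hg hgφ hgv).2
  have hgfin : ∀ᵐ x ∂μ, g x ≠ ⊤ := hg.2.1.ae_ne_top hp0 hg.1.1
  have hag := integrable_weight_mul_rpow (x₀ := x₀) (k := 2 * j) hu hum hg.2.1 hg.1.1 hα0.le h2j hR
  have hay := integrable_weight_mul_ratio_rpow (x₀ := x₀) hu hum hα hk h2j hR
  have hQint : Integrable (fun x => (β ^ 2 + ε) * (weight u x₀ R α (2 * j) x * (g x).toReal ^ p) +
      C * (weight u x₀ R α (2 * j) x * ratio u x₀ R x ^ p)) μ :=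
    (hag.const_mul _).add (hay.const_mul C)
  have hQnn : ∀ x, 0 ≤ (β ^ 2 + ε) * (weight u x₀ R α (2 * j) x * (g x).toReal ^ p) +
      C * (weight u x₀ R α (2 * j) x * ratio u x₀ R x ^ p) := fun x => by
    have h2 : 0 ≤ (g x).toReal ^ p := Real.rpow_nonneg ENNReal.toReal_nonneg p
    have h3 := Real.rpow_nonneg (ratio_nonneg (x₀ := x₀) hu hR x) p
    have h4 := weight_nonneg (x₀ := x₀) (R := R) (k := 2 * j) (α := α) hu x
    positivity
  have hintQ : ∫ x, ((β ^ 2 + ε) * (weight u x₀ R α (2 * j) x * (g x).toReal ^ p) +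
      C * (weight u x₀ R α (2 * j) x * ratio u x₀ R x ^ p)) ∂μ =
      (β ^ 2 + ε) * ∫ x, weight u x₀ R α (2 * j) x * (g x).toReal ^ p ∂μ +
        C * ∫ x, weight u x₀ R α (2 * j) x * ratio u x₀ R x ^ p ∂μ := by
    rw [← integral_const_mul, ← integral_const_mul]
    exact integral_add (hag.const_mul (β ^ 2 + ε)) (hay.const_mul C)
  rw [← hintQ]
  have hLint : Integrable (fun x => deriv (fun t : ℝ => -(t ^ (-δ))) (u x).toReal * φ x ^ 2) μ :=
    LocallyIntegrable.integrable_of_eq_zero hI2 (isCompact_closedBall x₀ (2 * R)) fun x hx => by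
      simp [hφeq, cutoff_eq_zero hR hx, hj0]
  -- Since `-2β = -α + 1`, squaring `φ` leaves an extra factor `u + 1`, and `u^{-δ-1}(u+1) ≥
  -- u^{-δ}`.
  have hlow : δ * ∫ x, mainDensity u x₀ R δ α (2 * j) x ∂μ ≤
      ∫ x, deriv (fun t : ℝ => -(t ^ (-δ))) (u x).toReal * φ x ^ 2 ∂μ := by
    rw [← integral_const_mul]
    refine integral_mono_ae (hI.const_mul δ) hLint ?_
    filter_upwards [hfin] with x hx
    have hU : 0 < (u x).toReal := EReal.toReal_pos (hu x) hx
    have hη := (cutoff_mem x₀ R x).1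
    have hw : 0 < (u x).toReal + 1 := by linarith
    rw [deriv_neg_rpow_neg hU, hφeq, mainDensity]
    have e1 : (((u x).toReal + 1) ^ (-β) * cutoff x₀ R x ^ j) ^ 2 =
        ((u x).toReal + 1) ^ (-α) * ((u x).toReal + 1) * cutoff x₀ R x ^ (2 * j) := by
      rw [mul_pow, ← pow_mul, mul_comm j 2]
      congr 1
      rw [← Real.rpow_natCast, ← Real.rpow_mul hw.le, ← Real.rpow_add_one hw.ne']
      congr 1
      rw [hβ]; push_cast; ring
    have e2 : (u x).toReal ^ (-δ) = (u x).toReal ^ (-δ - 1) * (u x).toReal := by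
      rw [← Real.rpow_add_one hU.ne']; congr 1; ring
    rw [e1, e2]
    have h3 : 0 ≤ δ * ((u x).toReal ^ (-δ - 1) * (((u x).toReal + 1) ^ (-α) *
      cutoff x₀ R x ^ (2 * j))) := by positivity
    nlinarith
  refine hlow.trans (le_of_ereal_le (mul_nonneg (by linarith) (integral_nonneg hQnn)) ?_ h1)
  rw [ENNReal.ofReal_mul (by linarith)]
  gcongr
  rw [ofReal_integral_eq_lintegral_ofReal hQint (Filter.Eventually.of_forall hQnn)]
  refine lintegral_mono_ae ?_
  filter_upwards [hgφle, hgfin] with x hx hgx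
  have hy0 : 0 ≤ ratio u x₀ R x := ratio_nonneg hu hR x
  have hU0 : 0 ≤ (u x).toReal := EReal.toReal_nonneg (hu x).le
  have hw : 0 < (u x).toReal + 1 := by linarith
  have hη := (cutoff_mem x₀ R x).1
  set b := weight u x₀ R β j x with hb
  have hb0 : 0 ≤ b := weight_nonneg hu x
  have hg0 : 0 ≤ (g x).toReal := ENNReal.toReal_nonneg
  have e1 : |testFunFst 0 1 β j (testPoint u x₀ R x)| = β * b := by
    rw [testFunFst, zero_sub, abs_neg, one_mul]
    exact abs_of_nonneg (mul_nonneg hβ0 hb0)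
  have e2 : |testFunSnd 1 β j (testPoint u x₀ R x)| * R⁻¹ = b * (j * ratio u x₀ R x) := by
    have h2 := weight_mul_ratio (x₀ := x₀) (α := β) hu hR hj x
    have h3 : testFunSnd 1 β j (testPoint u x₀ R x) =
        j * (((u x).toReal + 1) ^ (-β) * cutoff x₀ R x ^ (j - 1)) := by
      simp only [testFunSnd, testPoint]; ring
    rw [h3, abs_of_nonneg (by positivity), mul_assoc, ← h2]
    ring
  have e3 : b ^ 2 = weight u x₀ R α (2 * j) x := by
    rw [hb, weight, weight, mul_pow, ← pow_mul, mul_comm j 2]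
    congr 1
    rw [← Real.rpow_natCast, ← Real.rpow_mul hw.le]
    congr 1
    rw [hβ]; push_cast; ring
  rw [← ENNReal.ofReal_mul (abs_nonneg _), e1, e2, ← ENNReal.ofReal_toReal hgx,
    ← ENNReal.ofReal_mul (by positivity), ← ENNReal.ofReal_add (by positivity) (by positivity)] at hx
  calc g x ^ (p - 2) * gφ x ^ (2 : ℝ)
      ≤ ENNReal.ofReal ((g x).toReal) ^ (p - 2) *
        ENNReal.ofReal (β * b * (g x).toReal + b * (j * ratio u x₀ R x)) ^ (2 : ℝ) := by
        rw [ENNReal.ofReal_toReal hgx]; gcongr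
    _ = ENNReal.ofReal ((g x).toReal ^ (p - 2) *
        (β * b * (g x).toReal + b * (j * ratio u x₀ R x)) ^ 2) := by
        rw [ENNReal.ofReal_rpow_of_nonneg hg0 (by linarith),
          ENNReal.ofReal_rpow_of_nonneg (by positivity) (by norm_num),
          ← ENNReal.ofReal_mul (by positivity)]
        norm_num
    _ ≤ _ := by
        refine ENNReal.ofReal_le_ofReal ?_
        have h4 := mul_le_mul_of_nonneg_left (hC _ _ hg0 hy0) (sq_nonneg b)
        change _ ≤ (β ^ 2 + ε) * (weight u x₀ R α (2 * j) x * (g x).toReal ^ p) +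
          C * (weight u x₀ R α (2 * j) x * ratio u x₀ R x ^ p)
        rw [← e3]
        linarith

/-- The energy estimate for the test exponent `α`. -/
lemma IsVariationalMinimizer.exists_integral_le [Nonempty X] (hp : 2 ≤ p) (hδ : 0 < δ)
    (hmin : IsVariationalMinimizer p μ (fun t : ℝ => -(t ^ (-δ))) u) (hα : p - 1 < α)
    (hαδ : (p - 1) * ((α - 1) / 2) ^ 2 < δ * α) (x₀ : X) :
    ∃ (k : ℕ) (D : ℝ), 0 ≤ D ∧ ∀ R, 0 < R → Integrable (mainDensity u x₀ R δ α k) μ ∧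
      ∫ x, mainDensity u x₀ R δ α k x ∂μ ≤
        D * (R ^ (-(p * (δ + α) / (δ + p - 1))) * μ.real (Metric.closedBall x₀ (2 * R))) := by
  have hp0 : 0 < p := by linarith
  have hα0 : 0 < α := by linarith
  have hs : 0 < δ + p - 1 := by linarith
  have hu := hmin.2.1
  obtain ⟨hum, hfin, g', hg'u, hg'l⟩ := hmin.1.exists_isUpperGradient hp0
  obtain ⟨g, hg⟩ := exists_isMinimalWeakUpperGradient hp0 (hg'u.isWeakUpperGradient hp0) hg'l
  set q := p * (δ + α) / (δ + p - 1) with hq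
  obtain ⟨n, hn⟩ := exists_nat_ge q
  -- Gives `q ≤ 2j`, as needed for `weight_error_le`, and `2 ≤ j`, as needed for the test function.
  set j := n + 2 with hj
  have hqk : q ≤ (2 * j : ℕ) := by rw [hj]; push_cast; linarith [(Nat.cast_nonneg n : (0 : ℝ) ≤ n)]
  have hpq : p ≤ q := by rw [hq, le_div_iff₀ hs]; nlinarith
  have hk : p ≤ (2 * j : ℕ) := hpq.trans hqk
  set β := (α - 1) / 2 with hβ
  -- Uses up half of the gap in `hαδ`, so that `τ` below stays positive.
  set ε := (δ * α - (p - 1) * β ^ 2) / (2 * (p - 1)) with hε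
  have hp1 : 0 < p - 1 := by linarith
  have hε0 : 0 < ε := div_pos (by linarith) (by linarith)
  have hθ : (p - 1) * (β ^ 2 + ε) < δ * α := by
    have : (p - 1) * ε = (δ * α - (p - 1) * β ^ 2) / 2 := by rw [hε]; field_simp
    linarith
  obtain ⟨C, hC0, hC⟩ := exists_rpow_mul_add_sq_le (β := β) (j := j) hp hε0
  set A := (p - 1) * (β ^ 2 + ε) with hA
  have hA0 : 0 ≤ A := by positivity
  set B := A * (((2 * j : ℕ) : ℝ) / α) ^ p + (p - 1) * C with hB
  have hB0 : 0 ≤ B := by positivity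
  set τ := δ - A * α⁻¹ with hτ
  have hτ0 : 0 < τ := by
    rw [hτ, sub_pos, ← div_eq_mul_inv, div_lt_iff₀ hα0]; exact hθ
  -- Chosen so that `B * ε₃ ≤ τ / 2`, which lets half of `τ I` absorb the error.
  set ε₃ := τ / (2 * (B + 1)) with hε₃
  have hε₃0 : 0 < ε₃ := by positivity
  set M := ε₃ ^ (-((α + 1 - p) / (δ + p - 1))) with hM
  have hM0 : 0 ≤ M := by positivity
  refine ⟨2 * j, 2 * B * M / τ, by positivity, fun R hR => ?_⟩
  obtain ⟨hI, hcac⟩ := hmin.caccioppoli (x₀ := x₀) hp hg hum hfin hα hk hR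
  refine ⟨hI, ?_⟩
  have hstab := hmin.stability (x₀ := x₀) hp hδ hg hum hfin hα (by omega) hk hR hε0.le hC0 hC hI
  have herr : ∫ x, weight u x₀ R α (2 * j) x * ratio u x₀ R x ^ p ∂μ ≤
      ε₃ * ∫ x, mainDensity u x₀ R δ α (2 * j) x ∂μ +
        M * (R ^ (-q) * μ.real (Metric.closedBall x₀ (2 * R))) := by
    have hci : Integrable ((Metric.closedBall x₀ (2 * R)).indicator fun _ => M * R ^ (-q)) μ :=
      (integrable_indicator_iff measurableSet_closedBall).2
        (integrableOn_const (isCompact_closedBall x₀ (2 * R)).measure_lt_top.ne)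
    have e1 : ∫ x, (Metric.closedBall x₀ (2 * R)).indicator (fun _ => M * R ^ (-q)) x ∂μ =
        M * (R ^ (-q) * μ.real (Metric.closedBall x₀ (2 * R))) := by
      rw [integral_indicator measurableSet_closedBall, setIntegral_const, smul_eq_mul]; ring
    rw [← e1, ← integral_const_mul, ← integral_add (hI.const_mul _) hci]
    refine integral_mono_ae
      (integrable_weight_mul_ratio_rpow (x₀ := x₀) hu hum hα hk (by omega) hR)
      ((hI.const_mul _).add hci) ?_
    filter_upwards [hfin] with x hx
    by_cases hmem : x ∈ Metric.closedBall x₀ (2 * R)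
    · rw [indicator_of_mem hmem]
      have hU : 0 < (u x).toReal := EReal.toReal_pos (hu x) hx
      obtain ⟨hη0, hη1⟩ := cutoff_mem x₀ R x
      rcases hη0.eq_or_lt with h0 | h0
      · rw [weight, mainDensity, ← h0, zero_pow (by omega)]
        simp only [mul_zero, zero_mul, zero_add]
        positivity
      · have h2 := weight_error_le hs hα hqk hε₃0 (by linarith : 1 ≤ (u x).toReal + 1) h0 hη1 hR
        rw [Real.rpow_natCast] at h2
        refine h2.trans (add_le_add_left (mul_le_mul_of_nonneg_left ?_ hε₃0.le) _)
        rw [mainDensity, sub_eq_add_neg, Real.rpow_add (by linarith), mul_assoc]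
        refine mul_le_mul_of_nonneg_right ?_ (by positivity)
        -- `(u+1)^{-δ} ≤ u^{-δ}` passes from the pure power of `u + 1` to the density.
        exact Real.rpow_le_rpow_of_nonpos hU (by linarith) (by linarith)
    · rw [indicator_of_notMem hmem, weight_eq_zero (by omega) hR hmem,
        mainDensity_eq_zero (by omega) hR hmem]
      simp
  set I := ∫ x, mainDensity u x₀ R δ α (2 * j) x ∂μ
  set G := ∫ x, weight u x₀ R α (2 * j) x * (g x).toReal ^ p ∂μ
  set E := ∫ x, weight u x₀ R α (2 * j) x * ratio u x₀ R x ^ p ∂μ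
  set V := R ^ (-q) * μ.real (Metric.closedBall x₀ (2 * R))
  have hI0 : 0 ≤ I := integral_nonneg fun x => by
    have h1 : 0 ≤ (u x).toReal := EReal.toReal_nonneg (hu x).le
    have h2 := (cutoff_mem x₀ R x).1
    rw [mainDensity]; positivity
  have h1 : δ * I ≤ A * G + (p - 1) * C * E := hstab.trans_eq (by rw [hA]; ring)
  have h2 : A * G ≤ A * ((((2 * j : ℕ) : ℝ) / α) ^ p * E + α⁻¹ * I) :=
    mul_le_mul_of_nonneg_left hcac hA0
  have h3 : τ * I ≤ B * E := by
    rw [hτ, hB]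
    linear_combination h1 + h2
  have h4 : B * E ≤ B * (ε₃ * I + M * V) := mul_le_mul_of_nonneg_left herr hB0
  have h5 : B * ε₃ ≤ τ / 2 := by
    rw [hε₃, mul_div_assoc', div_le_div_iff₀ (by positivity) (by positivity)]
    nlinarith
  have h6 : B * ε₃ * I ≤ τ / 2 * I := mul_le_mul_of_nonneg_right h5 hI0
  have h7 : τ * I ≤ 2 * B * M * V := by linear_combination 2 * h3 + 2 * h4 + 2 * h6
  calc I ≤ 2 * B * M * V / τ := by rw [le_div_iff₀ hτ0]; linarith
    _ = _ := by ring

/-- The polynomial volume growth of a doubling measure, against a faster decaying power. -/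
lemma IsDoublingWith.tendsto_rpow_mul_measure {C q : ℝ} (h : IsDoublingWith μ C)
    (hq : Real.logb 2 C < q) (x₀ : X) :
    Filter.Tendsto (fun n : ℕ => ((2 : ℝ) ^ n) ^ (-q) *
      μ.real (Metric.closedBall x₀ (2 * 2 ^ n))) Filter.atTop (𝓝 0) := by
  have hC : 0 < C := zero_lt_one.trans_le h.1
  have h2q : C < (2 : ℝ) ^ q := (Real.logb_lt_iff_lt_rpow one_lt_two hC).1 hq
  -- Each doubling of the radius multiplies the volume by at most `C` and the power by `2^{-q}`; the
  -- hypothesis on `q` says `r < 1`.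
  set r := C / 2 ^ q with hr
  have hr1 : r < 1 := (div_lt_one (by positivity)).2 h2q
  have hlim := (tendsto_pow_atTop_nhds_zero_of_lt_one (by positivity : 0 ≤ r) hr1).mul_const
    (μ.real (Metric.ball x₀ 4))
  rw [zero_mul] at hlim
  refine squeeze_zero (fun n => by positivity) (fun n => ?_) hlim
  have hball : μ.real (Metric.closedBall x₀ (2 * 2 ^ n)) ≤ C ^ n * μ.real (Metric.ball x₀ 4) := by
    have h1 := h.measure_ball_two_pow_le x₀ (by norm_num : (0 : ℝ) < 4) n
    have h2 : μ (Metric.closedBall x₀ (2 * 2 ^ n)) ≤ μ (Metric.ball x₀ (2 ^ n * 4)) :=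
      measure_mono (Metric.closedBall_subset_ball (by
        have : (0 : ℝ) < 2 ^ n := by positivity
        linarith))
    have h3 := ENNReal.toReal_mono (ENNReal.mul_ne_top (ENNReal.pow_ne_top ENNReal.ofReal_ne_top)
      (h.measure_ball_lt_top x₀ 4).ne) (h2.trans h1)
    rwa [ENNReal.toReal_mul, ENNReal.toReal_pow, ENNReal.toReal_ofReal hC.le] at h3
  calc ((2 : ℝ) ^ n) ^ (-q) * μ.real (Metric.closedBall x₀ (2 * 2 ^ n))
      ≤ ((2 : ℝ) ^ n) ^ (-q) * (C ^ n * μ.real (Metric.ball x₀ 4)) := by gcongr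
    _ = r ^ n * μ.real (Metric.ball x₀ 4) := by
        rw [hr, div_pow, Real.rpow_neg (by positivity), ← Real.rpow_natCast 2 n,
          ← Real.rpow_natCast (2 ^ q) n, ← Real.rpow_mul zero_le_two, ← Real.rpow_mul zero_le_two,
          mul_comm q]
        ring

end MetricNewtonian

end

theorem theorem2p1 {X : Type*} [MetricSpace X] [CompleteSpace X] [Nonempty X]
    [MeasurableSpace X] [BorelSpace X] (μ : MeasureTheory.Measure X)
    (p δ δp Cμ m : ℝ) (hp : 2 ≤ p)
    (hdoubling : MetricNewtonian.IsDoublingWith μ Cμ)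
    (hpoincare : MetricNewtonian.SupportsPoincare p μ)
    (hm_def : m = Real.logb 2 Cμ)
    (hδ : (p ^ 2 - 3 * p + 2) ^ 2 / (4 * (p - 1) ^ 2) < δ)
    (hδp_def : δp = (2 * δ + p - 1 + 2 * Real.sqrt (δ * (δ + p - 1))) / (p - 1))
    (hm : m < p * (δ + δp) / (δ + p - 1)) :
    ¬ ∃ u : X → EReal,
      MetricNewtonian.IsVariationalMinimizer p μ (fun t : ℝ => -(t ^ (-δ))) u := by
  open MetricNewtonian in
  rintro ⟨u, hmin⟩
  have : ProperSpace X := hdoubling.properSpace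
  have : IsLocallyFiniteMeasure μ :=
    ⟨fun x => ⟨Metric.ball x 1, Metric.ball_mem_nhds x one_pos, hdoubling.measure_ball_lt_top x 1⟩⟩
  obtain ⟨hδ0, α, hα, hαδ, hmα⟩ := exists_test_exponent hp hδ hδp_def hm
  obtain ⟨x₀⟩ := ‹Nonempty X›
  have : Nonempty X := ⟨x₀⟩
  obtain ⟨k, D, hD, hest⟩ := hmin.exists_integral_le hp hδ0 hα hαδ x₀
  obtain ⟨-, hfin, -⟩ := hmin.1.exists_isUpperGradient (by linarith)
  have hu := hmin.2.1
  have hnn : ∀ R x, 0 ≤ mainDensity u x₀ R δ α k x := fun R x => by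
    have h1 : 0 ≤ (u x).toReal := EReal.toReal_nonneg (hu x).le
    have h2 := (cutoff_mem x₀ R x).1
    rw [mainDensity]; positivity
  have hlim := ((hdoubling.tendsto_rpow_mul_measure (hm_def ▸ hmα) x₀).const_mul D)
  rw [mul_zero] at hlim
  -- On the unit ball every cutoff of radius `2^n ≥ 1` equals 1, so the left side does not depend on
  -- `n`.
  have hle : ∀ n : ℕ, ∫ x in Metric.ball x₀ 1, mainDensity u x₀ 1 δ α k x ∂μ ≤
      D * (((2 : ℝ) ^ n) ^ (-(p * (δ + α) / (δ + p - 1))) *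
        μ.real (Metric.closedBall x₀ (2 * 2 ^ n))) := by
    intro n
    have hR : (0 : ℝ) < 2 ^ n := by positivity
    have h1R : (1 : ℝ) ≤ 2 ^ n := one_le_pow₀ one_le_two
    obtain ⟨hI, hb⟩ := hest _ hR
    refine le_trans (le_of_eq ?_) ((setIntegral_le_integral (s := Metric.ball x₀ 1) hI
      (Filter.Eventually.of_forall (hnn _))).trans hb)
    refine setIntegral_congr_fun Metric.isOpen_ball.measurableSet fun x hx => ?_
    simp only [mainDensity]
    rw [cutoff_eq_one one_pos hx, cutoff_eq_one hR (Metric.ball_subset_ball h1R hx)]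
  have hzero : ∫ x in Metric.ball x₀ 1, mainDensity u x₀ 1 δ α k x ∂μ = 0 :=
    le_antisymm (ge_of_tendsto' hlim hle) (integral_nonneg (hnn 1))
  rw [integral_eq_zero_iff_of_nonneg (hnn 1) (hest 1 one_pos).1.integrableOn] at hzero
  have hfalse : ∀ᵐ x ∂μ.restrict (Metric.ball x₀ 1), False := by
    filter_upwards [hzero, ae_restrict_of_ae hfin, ae_restrict_mem Metric.isOpen_ball.measurableSet]
      with x hx hxt hmem
    have hU : 0 < (u x).toReal := EReal.toReal_pos (hu x) hxt
    have hpos : 0 < mainDensity u x₀ 1 δ α k x := by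
      rw [mainDensity, cutoff_eq_one one_pos hmem]
      positivity
    exact hpos.ne' hx
  rw [Filter.eventually_false_iff_eq_bot, ae_eq_bot, Measure.restrict_eq_zero] at hfalse
  exact (hdoubling.measure_ball_pos x₀ one_pos).ne' hfalse
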